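/- All polytopes are in $\mathbb{R}^2$. A lattice polytope is the convex hull of finitely many points of $\mathbb{Z}^2$. Let $\Delta$ be a lattice polytope that is \emph{nonhyperelliptic} (its interior lattice points are not collinear) and \emph{maximal} (no lattice polytope $\Delta' \supsetneq \Delta$ has the same interior lattice points as $\Delta$). Let $\Delta^{(1)}$ be the convex hull of the interior lattice points of $\Delta$; let $r$ and $r^{(1)}$ be the numbers of lattice points on the boundaries of $\Delta$ and of $\Delta^{(1)}$. Let $c(\Delta)$ be the number of \emph{column vectors} of $\Delta$, i.e. of nonzero $v \in \mathbb{Z}^2$ for which there is a facet (edge) $\tau$ of $\Delta$ with $v + ((\Delta\setminus\tau)\cap\mathbb{Z}^2) \subset \Delta$. A \emph{legal move} is a pair $(v,w)$ of vectors of $\mathbb{Z}^2$ such that $\mathrm{conv}\{0,v,w\}$ is a $2$-dimensional triangle whose only nonzero lattice points lie on the edge between $v$ and $w$; its length is $\ell(v,w)=\det\begin{pmatrix} v\\ w\end{pmatrix}$, which may be negative. A \emph{legal loop} is a cyclic sequence $v_1,\dots,v_m\in\mathbb{Z}^2$ such that every $(v_i,v_{i+1})$ is a legal move and no three cyclically consecutive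 terms $v_{i-1},v_i,v_{i+1}$ lie on a line. For a cyclic sequence $\mathcal{P}=(v_i)$ put $\ell(\mathcal{P})=\sum_i \det\begin{pmatrix} v_i\\ v_{i+1}\end{pmatrix}$, and for a legal loop $\mathcal{P}$ let $\mathcal{P}^\vee=(w_i)$ with $w_i=\ell(v_i,v_{i+1})^{-1}(v_{i+1}-v_i)$ be the dual loop. Let $p_1,\dots,p_n$ be the vertices of $\Delta^{(1)}$ in counterclockwise order. For each $i$, let $p_i^{(-1)}$ be the intersection point of the lines $a_1X+a_2Y=b+1$, where $a_1X+a_2Y\le b$ (with $a_1,a_2\in\mathbb{Z}$ coprime) runs through the inequalities defining the two edges of $\Delta^{(1)}$ that contain $p_i$. Let $q_i=p_i^{(-1)}-p_i$, and let $\mathcal{P}(\Delta)$ be the cyclic sequence $q_1,\dots,q_n$ in which each block of cyclically consecutive equal terms is replaced by a single term. Then $\mathcal{P}(\Delta)$ exists and is a legal loop, and (a) $r - r^{(1)} = \ell(\mathcal{P}(\Delta)) \leq 9$; (b) $r - r^{(1)} - c(\Delta) \leq \min\left(\ell(\mathcal{P}(\Delta)),\ell(\mathcal{P}(\Delta)^\vee)\right)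 \leq 6$. -/

import Mathlib

/-- The inclusion of the lattice `ℤ²` in the plane `ℝ²`. -/
def toPlane (p : ℤ × ℤ) : ℝ × ℝ := ((p.1 : ℝ), (p.2 : ℝ))

/-- The determinant of the matrix with rows `v` and `w`. -/
def det₂ (v w : ℝ × ℝ) : ℝ := v.1 * w.2 - v.2 * w.1

/-- A lattice polytope in the plane: the convex hull of finitely many lattice points. -/
def IsLatticePolytope (Δ : Set (ℝ × ℝ)) : Prop :=
  ∃ S : Finset (ℤ × ℤ), Δ = convexHull ℝ (toPlane '' (S : Set (ℤ × ℤ)))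

/-- The lattice points in the interior of `Δ`. -/
def interiorLatticePoints (Δ : Set (ℝ × ℝ)) : Set (ℤ × ℤ) :=
  {p | toPlane p ∈ interior Δ}

/-- `Δ⁽¹⁾`, the convex hull of the interior lattice points of `Δ`. -/
def interiorPolytope (Δ : Set (ℝ × ℝ)) : Set (ℝ × ℝ) :=
  convexHull ℝ (toPlane '' interiorLatticePoints Δ)

/-- The number of lattice points on the boundary of `Δ`. -/
noncomputable def boundaryCount (Δ : Set (ℝ × ℝ)) : ℕ :=
  {p : ℤ × ℤ | toPlane p ∈ frontier Δ}.ncard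

/-- `Δ` is nonhyperelliptic: its interior lattice points are not collinear. -/
def IsNonhyperelliptic (Δ : Set (ℝ × ℝ)) : Prop :=
  ¬ Collinear ℝ (toPlane '' interiorLatticePoints Δ)

/-- `Δ` is maximal: it is not properly contained in a lattice polytope
with the same interior lattice points. -/
def IsMaximalPolytope (Δ : Set (ℝ × ℝ)) : Prop :=
  ∀ Δ' : Set (ℝ × ℝ), IsLatticePolytope Δ' → Δ ⊂ Δ' →
    interiorLatticePoints Δ' ≠ interiorLatticePoints Δ

/-- The linear form `a₁ X + a₂ Y`. -/
def linForm (a : ℤ × ℤ) (x : ℝ × ℝ) : ℝ := (a.1 : ℝ) * x.1 + (a.2 : ℝ) * x.2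

/-- The inequality `a₁ X + a₂ Y ≤ b`, with `a₁`, `a₂` coprime, defines a facet of the
(two-dimensional) polytope `Δ`: it holds on `Δ`, and it is an equality at two distinct points. -/
def IsFacetInequality (Δ : Set (ℝ × ℝ)) (a : ℤ × ℤ) (b : ℤ) : Prop :=
  IsCoprime a.1 a.2 ∧ (∀ x ∈ Δ, linForm a x ≤ b) ∧ {x ∈ Δ | linForm a x = b}.Nontrivial

/-- `τ` is a facet (an edge) of the two-dimensional lattice polytope `Δ`. -/
def IsFacet (Δ τ : Set (ℝ × ℝ)) : Prop :=
  ∃ (a : ℤ × ℤ) (b : ℤ), IsFacetInequality Δ a b ∧ τ = {x ∈ Δ | linForm a x = b}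

/-- `v` is a column vector of `Δ`, for some base facet `τ`. -/
def IsColumnVector (Δ : Set (ℝ × ℝ)) (v : ℤ × ℤ) : Prop :=
  v ≠ 0 ∧ ∃ τ, IsFacet Δ τ ∧ ∀ p : ℤ × ℤ, toPlane p ∈ Δ \ τ → toPlane (v + p) ∈ Δ

/-- `c(Δ)`, the number of column vectors of `Δ`. -/
noncomputable def columnCount (Δ : Set (ℝ × ℝ)) : ℕ :=
  {v : ℤ × ℤ | IsColumnVector Δ v}.ncard

/-- `(v, w)` is a legal move: `v` and `w` are lattice vectors, and `conv {0, v, w}` is a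
two-dimensional triangle whose only nonzero lattice points lie on the edge from `v` to `w`. -/
def IsLegalMove (v w : ℝ × ℝ) : Prop :=
  v ∈ Set.range toPlane ∧ w ∈ Set.range toPlane ∧
  ¬ Collinear ℝ {0, v, w} ∧
  ∀ p : ℤ × ℤ, p ≠ 0 → toPlane p ∈ convexHull ℝ {0, v, w} → toPlane p ∈ segment ℝ v w

/-- A legal loop. The index that follows `i` cyclically is `finRotate n i`. -/
def IsLegalLoop {n : ℕ} (v : Fin n → ℝ × ℝ) : Prop :=
  (∀ i, IsLegalMove (v i) (v (finRotate n i))) ∧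
  ∀ i, ¬ Collinear ℝ {v i, v (finRotate n i), v (finRotate n (finRotate n i))}

/-- The length of a loop: the sum of the lengths `det (v i, v (i + 1))` of its moves. -/
def loopLength {n : ℕ} (v : Fin n → ℝ × ℝ) : ℝ :=
  ∑ i, det₂ (v i) (v (finRotate n i))

/-- The dual loop `i ↦ ℓ(v i, v (i + 1))⁻¹ (v (i + 1) - v i)`. -/
noncomputable def dualLoop {n : ℕ} (v : Fin n → ℝ × ℝ) : Fin n → ℝ × ℝ :=
  fun i => (det₂ (v i) (v (finRotate n i)))⁻¹ • (v (finRotate n i) - v i)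

/-- `p` enumerates the vertices of the two-dimensional polytope `P` counterclockwise: each vertex
occurs exactly once, and `P` lies to the left of the directed line from each vertex of the
list to the next one. -/
def IsCounterclockwiseEnum (P : Set (ℝ × ℝ)) {n : ℕ} (p : Fin n → ℝ × ℝ) : Prop :=
  Function.Injective p ∧ Set.range p = P.extremePoints ℝ ∧
  ∀ i, ∀ x ∈ P, 0 ≤ det₂ (p (finRotate n i) - p i) (x - p i)

/-- `p'` is the relaxed vertex of the vertex `p` of the two-dimensional lattice polytope `P`:
it lies on the boundary line `a₁ X + a₂ Y = b + 1` of the relaxed inequality of each of the (two)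
facets `a₁ X + a₂ Y ≤ b` of `P` that contain `p`. -/
def IsRelaxedVertex (P : Set (ℝ × ℝ)) (p p' : ℝ × ℝ) : Prop :=
  ∀ (a : ℤ × ℤ) (b : ℤ), IsFacetInequality P a b → linForm a p = b → linForm a p' = b + 1

/-- `v` is obtained from the cyclic sequence `q` by replacing each maximal block of
cyclically consecutive equal terms by a single term (the last one of the block is kept). -/
def OmitsRepetitions {m n : ℕ} (v : Fin m → ℝ × ℝ) (q : Fin n → ℝ × ℝ) : Prop :=
  ∃ k : Fin m → Fin n, StrictMono k ∧ Set.range k = {i | q i ≠ q (finRotate n i)} ∧ v = q ∘ k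

/-- `v` is the loop `𝒫(Δ)` associated to `Δ`: the cyclic sequence of the vectors
`q i = (p i)⁽⁻¹⁾ - p i`, where `p` enumerates the vertices of `Δ⁽¹⁾` counterclockwise
and `(p i)⁽⁻¹⁾` is the relaxed vertex of `p i`; consecutive repetitions are omitted. -/
def IsAssociatedLoop (Δ : Set (ℝ × ℝ)) {m : ℕ} (v : Fin m → ℝ × ℝ) : Prop :=
  ∃ (n : ℕ) (p p' : Fin n → ℝ × ℝ),
    IsCounterclockwiseEnum (interiorPolytope Δ) p ∧
    (∀ i, IsRelaxedVertex (interiorPolytope Δ) (p i) (p' i)) ∧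
    OmitsRepetitions v (fun i => p' i - p i)

/-! Let `e i` be the primitive edge vectors of Δ⁽¹⁾, `l i` the lattice lengths of its edges, and `q
i` the relaxed vertex minus the vertex at the start of edge `i`. Each `q i` is a lattice vector with
determinant one against the two edge vectors at its vertex (`EdgeData.exists_relaxed_vertex`). Hence
q_{i+1} = q_i + L_i e_i and e_{i+1} = e_i - d_i q_{i+1}, with d_i ≥ 1. The loop has length ∑ L_i.
Its dual consists of the e_i with L_i ≠ 0 and has length ∑ d_i, since dropping a repeated q_i merges
dual moves along one line (`RelaxData.exists_subloop`).

By maximality, Δ is cut out by the relaxed edge inequalities of Δ⁽¹⁾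
(`EdgeData.mem_iff_of_isMaximal`). Its edges thus have lattice lengths l_i + L_i, and comparing
perimeters gives r - r⁽¹⁾ = ∑ L_i.

The crux is ∑ L_i + ∑ d_i = 12 (`sum_add_sum_eq_twelve`). The pairs (e_i, q_i) are bases of ℤ² of
one orientation. Read in ℂ, e¹² η(-q/e)⁻²⁴ is, up to a constant, the inverse discriminant of the
lattice, so it is the same for all these bases. Its logarithm changes by 2πi L_i when q_i becomes
q_{i+1}, and by 2πi d_i when e_i becomes e_{i+1}, except that the principal logarithm of e loses 2πi
at each crossing of its cut. The total change around the cycle is zero, and the edges of a convex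
polygon turn once (`EdgeData.sum_top_eq_one`).

The loop has m ≥ 3 terms and every dual move has length at least one, so ∑ d_i ≥ m ≥ 3 and ∑ L_i ≤
9; two integers with sum 12 have minimum at most 6. An edge with L_i ≥ 2 yields L_i - 1 column
vectors (`EdgeData.sum_le_columnCount`), so ∑ L_i - c(Δ) ≤ m ≤ ∑ d_i. -/

/-! ### A continuous logarithm of the eta function -/

open Complex in
lemma eqOn_const_of_exp_eq_const {S : Set ℂ} (hS : IsPreconnected S) {f : ℂ → ℂ}
    (hf : ContinuousOn f S) (hc : ∀ x ∈ S, exp (f x) = 1) {x y : ℂ} (hx : x ∈ S) (hy : y ∈ S) :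
    f x = f y := by
  have key : ∀ x ∈ S, ∃ n : ℤ, f x = n * (2 * Real.pi * I) := fun x hx =>
    Complex.exp_eq_one_iff.1 (hc x hx)
  have hpi : (2 * Real.pi : ℝ) ≠ 0 := by positivity
  let g : ℂ → ℝ := fun z => (f z).im / (2 * Real.pi)
  have hg : ContinuousOn g S := (Complex.continuous_im.comp_continuousOn hf).div_const _
  have hgn : ∀ x ∈ S, ∀ n : ℤ, f x = n * (2 * Real.pi * I) → g x = n := by
    intro x hx n hn
    simp only [g]
    rw [hn]
    simp
  have hm : Set.MapsTo g S (Set.range ((↑) : ℤ → ℝ)) := by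
    intro x hx
    obtain ⟨n, hn⟩ := key x hx
    exact ⟨n, (hgn x hx n hn).symm⟩
  have hd : DiscreteTopology (Set.range ((↑) : ℤ → ℝ)) :=
    (Int.isClosedEmbedding_coe_real.isEmbedding.toHomeomorph).symm.isEmbedding.discreteTopology
  have hxy := hS.constant_of_mapsTo (isDiscrete_iff_discreteTopology.mpr hd) hg hm hx hy
  obtain ⟨n, hn⟩ := key x hx
  obtain ⟨k, hk⟩ := key y hy
  rw [hgn x hx n hn, hgn y hy k hk] at hxy
  have : n = k := by exact_mod_cast hxy
  rw [hn, hk, this]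

open UpperHalfPlane hiding I in
open Complex in
/-- A continuous logarithm of the Dedekind eta function, with its transformation laws. -/
lemma exists_log_eta : ∃ L : ℂ → ℂ,
    (∀ z : ℂ, 0 < z.im → L (z + 1) = L z + Real.pi * I / 12) ∧
    (∀ z : ℂ, 0 < z.im → L (-1 / z) = L z + Complex.log z / 2 - Real.pi * I / 4) := by
  have hconv : Convex ℝ upperHalfPlaneSet := convex_halfSpace_im_gt 0
  have hpre : IsPreconnected upperHalfPlaneSet := hconv.isPreconnected
  have hI : I ∈ upperHalfPlaneSet := by simp [upperHalfPlaneSet]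
  have hsc : IsSimplyConnected upperHalfPlaneSet := by
    have := hconv.contractibleSpace ⟨I, hI⟩
    exact (inferInstance : SimplyConnectedSpace upperHalfPlaneSet)
  obtain ⟨L, hLc, hL⟩ := exists_continuousOn_eqOn_exp_comp hsc isOpen_upperHalfPlaneSet
    (g := ModularForm.eta)
    (fun z hz => (ModularForm.differentiableAt_eta_of_mem_upperHalfPlaneSet
      hz).continuousAt.continuousWithinAt)
    (by rintro ⟨z, hz, h⟩; exact ModularForm.eta_ne_zero hz h)
  have hL' : ∀ z : ℂ, 0 < z.im → exp (L z) = ModularForm.eta z := fun z hz => hL hz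
  have hinv : ∀ z : ℂ, 0 < z.im → 0 < (-1 / z).im := by
    intro z hz
    have hz0 : z ≠ 0 := by rintro rfl; simp at hz
    rw [neg_div, one_div, neg_im, inv_im]
    have := normSq_pos.2 hz0
    rw [neg_div, neg_neg]
    positivity
  have hS : ∀ z : ℂ, 0 < z.im →
      L (-1 / z) = L z + Complex.log z / 2 - Real.pi * I / 4 := by
    have hslit : ∀ z : ℂ, 0 < z.im → z ∈ slitPlane := fun z hz => Or.inr hz.ne'
    have hcont : ContinuousOn (fun z => L (-1 / z) - (L z + Complex.log z / 2 - Real.pi * I / 4))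
        upperHalfPlaneSet := by
      refine ContinuousOn.sub ?_ ?_
      · refine hLc.comp (t := upperHalfPlaneSet) ?_ (fun z hz => hinv z hz)
        refine continuousOn_const.div continuousOn_id ?_
        rintro z hz rfl
        simp [upperHalfPlaneSet] at hz
      · refine ((hLc.add ?_)).sub continuousOn_const
        refine ContinuousOn.div_const (fun z hz => ?_) _
        exact (continuousAt_clog (hslit z hz)).continuousWithinAt
    have hlogI : Complex.log I / 2 - Real.pi * I / 4 = 0 := by
      rw [log_I]; ring
    have hone : ∀ z ∈ upperHalfPlaneSet,
        exp (L (-1 / z) - (L z + Complex.log z / 2 - Real.pi * I / 4)) = 1 := by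
      intro z hz
      have hz0 : z ≠ 0 := by rintro rfl; simp [upperHalfPlaneSet] at hz
      have h1 := ModularForm.eta_comp_eq_csqrt_I_inv hz
      have h2 := hL' _ (hinv z hz)
      simp only [Function.comp_apply, Pi.smul_apply, Pi.mul_apply, smul_eq_mul] at h1
      rw [h1, sqrt_eq_exp hz0, sqrt_eq_exp I_ne_zero, log_I, ← hL' z hz, ← exp_neg, ← exp_add,
        ← exp_add] at h2
      rw [exp_sub, h2, ← exp_sub, ← exp_zero]
      congr 1
      ring
    intro z hz
    -- The point `I` is fixed by z ↦ -1/z and log I = πi/2, so the constant difference vanishes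
    -- there.
    have := eqOn_const_of_exp_eq_const hpre hcont hone (x := z) (y := I) hz hI
    have hII : (-1 / I : ℂ) = I := by rw [neg_div, one_div, inv_I, neg_neg]
    simp only [hII] at this
    have h0 : L I - (L I + Complex.log I / 2 - Real.pi * I / 4) = 0 := by
      rw [add_sub_assoc, hlogI]; ring
    rw [h0] at this
    exact sub_eq_zero.1 this
  refine ⟨L, ?_, hS⟩
  have hT : ∀ z : ℂ, ModularForm.eta (z + 1) = exp (Real.pi * I / 12) * ModularForm.eta z := by
    intro z
    have hq : Function.Periodic.qParam 1 (z + 1) = Function.Periodic.qParam 1 z := by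
      simp only [Function.Periodic.qParam]
      rw [← Complex.exp_periodic (2 * Real.pi * I * z / (1 : ℝ))]
      congr 1
      push_cast
      ring
    have hq' : Function.Periodic.qParam 24 (z + 1)
        = exp (Real.pi * I / 12) * Function.Periodic.qParam 24 z := by
      simp only [Function.Periodic.qParam, ← exp_add]
      congr 1
      push_cast
      ring
    simp only [ModularForm.eta, ModularForm.eta_q, hq, hq', mul_assoc]
  have hcont : ContinuousOn (fun z => L (z + 1) - (L z + Real.pi * I / 12)) upperHalfPlaneSet := by
    refine ContinuousOn.sub ?_ (hLc.add continuousOn_const)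
    refine hLc.comp (t := upperHalfPlaneSet) (by fun_prop) (fun z hz => ?_)
    simpa [upperHalfPlaneSet] using hz
  have hone : ∀ z ∈ upperHalfPlaneSet, exp (L (z + 1) - (L z + Real.pi * I / 12)) = 1 := by
    intro z hz
    have hz1 : 0 < (z + 1).im := by simpa [upperHalfPlaneSet] using hz
    rw [exp_sub, exp_add, hL' _ hz1, hL' z hz, hT, mul_comm]
    exact div_self (mul_ne_zero (ModularForm.eta_ne_zero hz) (exp_ne_zero _))
  intro z hz
  -- the constant is determined at the primitive cube root of unity
  set ρ : ℂ := exp ((2 * Real.pi / 3 : ℝ) * I) with hρ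
  have hρim : 0 < ρ.im := by
    rw [hρ, exp_ofReal_mul_I_im]
    exact Real.sin_pos_of_pos_of_lt_pi (by positivity) (by linarith [Real.pi_pos])
  have hρlog : Complex.log ρ = (2 * Real.pi / 3 : ℝ) * I := by
    rw [hρ, Complex.log_exp] <;> simp <;> linarith [Real.pi_pos]
  have hρ3 : ρ ^ 3 = 1 := by
    rw [hρ, ← exp_nat_mul, ← exp_two_pi_mul_I]
    congr 1
    push_cast
    ring
  have hρ0 : ρ ≠ 0 := exp_ne_zero _
  have hρ1 : ρ - 1 ≠ 0 := by
    intro h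
    rw [sub_eq_zero.1 h] at hρim
    simp at hρim
  -- The inversion law at ρ is thus also a translation law: (2πi/3)/2 - πi/4 = πi/12.
  have hρinv : -1 / ρ = ρ + 1 := by
    have h : ρ ^ 2 + ρ + 1 = 0 := by
      apply mul_left_cancel₀ hρ1
      linear_combination hρ3
    rw [div_eq_iff hρ0]
    linear_combination -h
  have hSρ := hS ρ hρim
  rw [hρinv, hρlog] at hSρ
  have := eqOn_const_of_exp_eq_const hpre hcont hone (x := z) (y := ρ) hz hρim
  have h0 : L (ρ + 1) - (L ρ + Real.pi * I / 12) = 0 := by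
    rw [hSρ]; push_cast; ring
  rw [h0] at this
  exact sub_eq_zero.1 this

/-! ### The number 12 -/

/-- The Gaussian integer attached to a lattice vector. -/
noncomputable def gaussian (v : ℤ × ℤ) : ℂ := (v.1 : ℂ) + (v.2 : ℂ) * Complex.I

lemma gaussian_re (v : ℤ × ℤ) : (gaussian v).re = v.1 := by simp [gaussian]

lemma gaussian_im (v : ℤ × ℤ) : (gaussian v).im = v.2 := by simp [gaussian]

lemma gaussian_ne_zero {e v : ℤ × ℤ} (h : e.1 * v.2 - e.2 * v.1 = 1) : gaussian e ≠ 0 := by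
  intro h0
  have h1 := congrArg Complex.re h0
  have h2 := congrArg Complex.im h0
  rw [gaussian_re] at h1
  rw [gaussian_im] at h2
  have h1' : e.1 = 0 := by exact_mod_cast h1
  have h2' : e.2 = 0 := by exact_mod_cast h2
  simp [h1', h2'] at h

lemma gaussian_div_im_pos {e v : ℤ × ℤ} (h : e.1 * v.2 - e.2 * v.1 = 1) :
    0 < (gaussian v / gaussian e).im := by
  have h0 := Complex.normSq_pos.2 (gaussian_ne_zero h)
  rw [Complex.div_im, gaussian_re, gaussian_im, gaussian_re, gaussian_im, ← sub_div]
  apply div_pos _ h0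
  have : (e.1 : ℝ) * v.2 - e.2 * v.1 = 1 := by exact_mod_cast h
  linarith

-- Branch control: logarithms of the same number differ by 2πi n, and the bounds force n = 0.
open Complex in
lemma eq_add_of_exp_eq {a b : ℂ} (h : exp a = exp b) (h1 : -(2 * Real.pi) < (a - b).im)
    (h2 : (a - b).im < 2 * Real.pi) : a = b := by
  obtain ⟨n, hn⟩ := Complex.exp_eq_exp_iff_exists_int.1 h
  have him : (a - b).im = n * (2 * Real.pi) := by
    rw [hn]; simp
  rw [him] at h1 h2
  have hpi : 0 < 2 * Real.pi := by positivity
  have hn1 : (-1 : ℝ) < n := by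
    by_contra hc
    push Not at hc
    nlinarith
  have hn2 : (n : ℝ) < 1 := by
    by_contra hc
    push Not at hc
    nlinarith
  have hn1' : (-1 : ℤ) < n := by exact_mod_cast hn1
  have hn2' : n < (1 : ℤ) := by exact_mod_cast hn2
  have : n = 0 := by omega
  simpa [this] using hn

lemma arg_pos_lt_pi {z : ℂ} (hz : 0 < z.im) : 0 < Complex.arg z ∧ Complex.arg z < Real.pi := by
  refine ⟨lt_of_le_of_ne (Complex.arg_nonneg_iff.2 hz.le) fun h => ?_,
    lt_of_le_of_ne (Complex.arg_le_pi z) fun h => ?_⟩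
  · exact hz.ne' (Complex.arg_eq_zero_iff.1 h.symm).2
  · exact hz.ne' (Complex.arg_eq_pi_iff.1 h).2

lemma logEta_add_int {L : ℂ → ℂ}
    (hT : ∀ z : ℂ, 0 < z.im → L (z + 1) = L z + Real.pi * Complex.I / 12) (k : ℤ) (z : ℂ)
    (hz : 0 < z.im) : L (z + k) = L z + k * (Real.pi * Complex.I / 12) := by
  have hnat : ∀ (n : ℕ) (z : ℂ), 0 < z.im → L (z + n) = L z + n * (Real.pi * Complex.I / 12) := by
    intro n
    induction n with
    | zero => intro z _; simp
    | succ n ih =>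
      intro z hz
      have h1 := hT (z + n) (by simpa using hz)
      rw [Nat.cast_add_one, ← add_assoc, h1, ih z hz]
      ring
  obtain ⟨n, rfl | rfl⟩ := k.eq_nat_or_neg
  · exact_mod_cast hnat n z hz
  · have h1 := hnat n (z + ((-n : ℤ) : ℂ)) (by simpa using hz)
    push_cast at h1 ⊢
    rw [neg_add_cancel_right] at h1
    rw [h1]
    ring

-- The map is inversion, translation by `-d`, inversion: τ/(1 + dτ) = -1/w with w = -1/τ - d. The
-- two logarithms produced combine because τw = -(1 + dτ) and all three arguments lie in (0, π).
open Complex in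
lemma logEta_div_one_add {L : ℂ → ℂ}
    (hT : ∀ z : ℂ, 0 < z.im → L (z + 1) = L z + Real.pi * I / 12)
    (hS : ∀ z : ℂ, 0 < z.im → L (-1 / z) = L z + log z / 2 - Real.pi * I / 4) (d : ℤ)
    (hd : 1 ≤ d) (τ : ℂ) (hτ : 0 < τ.im) :
    24 * L (τ / (1 + d * τ)) = 24 * L τ + 12 * log (1 + d * τ) - 2 * Real.pi * I * d := by
  have hd' : (0 : ℝ) < d := by exact_mod_cast hd
  have hτ0 : τ ≠ 0 := by rintro rfl; simp at hτ
  have hinv : 0 < (-1 / τ).im := by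
    rw [neg_div, one_div, neg_im, inv_im, neg_div, neg_neg]
    have := normSq_pos.2 hτ0
    positivity
  have him : 0 < (1 + d * τ).im := by
    have : (1 + d * τ).im = d * τ.im := by simp
    rw [this]; positivity
  have h10 : 1 + d * τ ≠ 0 := by intro h; rw [h] at him; simp at him
  set w : ℂ := -1 / τ + ((-d : ℤ) : ℂ) with hw
  have hwim : 0 < w.im := by
    rw [hw]; simpa using hinv
  have hw0 : w ≠ 0 := by intro h; rw [h] at hwim; simp at hwim
  have hmul : τ * w = -(1 + d * τ) := by
    rw [hw]; push_cast; field_simp; ring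
  have hfrac : -1 / w = τ / (1 + d * τ) := by
    rw [div_eq_div_iff hw0 h10]
    linear_combination -hmul
  have h1 := hS w hwim
  have h2 := logEta_add_int hT (-d) (-1 / τ) hinv
  have h3 := hS τ hτ
  rw [hfrac] at h1
  rw [← hw, h3] at h2
  have hlog : log τ + log w = log (1 + d * τ) + Real.pi * I := by
    apply eq_add_of_exp_eq
    · rw [exp_add, exp_add, exp_log hτ0, exp_log hw0, exp_log h10, exp_pi_mul_I, hmul]
      ring
    all_goals
      have a1 := arg_pos_lt_pi hτ
      have a2 := arg_pos_lt_pi hwim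
      have a3 := arg_pos_lt_pi him
      have e1 : (log τ + log w - (log (1 + d * τ) + Real.pi * I)).im
          = arg τ + arg w - (arg (1 + d * τ) + Real.pi) := by
        simp only [sub_im, add_im, log_im]
        simp
      rw [e1]
      linarith
  rw [h1, h2]
  push_cast
  linear_combination 12 * hlog

-- Multiplication by 1 + dτ, whose argument lies in (0, π), turns `e` counterclockwise by less than
-- half a turn. The principal logarithm drops by 2πi exactly when the turn crosses the negative real
-- axis, which itself belongs to the upper side.
open Complex in
lemma log_gaussian_add {e v : ℤ × ℤ} (h : e.1 * v.2 - e.2 * v.1 = 1) {d : ℤ} (hd : 1 ≤ d) :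
    log (gaussian (e + d • v)) = log (gaussian e) + log (1 + d * (gaussian v / gaussian e))
      - 2 * Real.pi * I * (if 0 ≤ e.2 ∧ (e + d • v).2 < 0 then 1 else 0 : ℤ) := by
  have hd' : (0 : ℝ) < d := by exact_mod_cast hd
  have he0 := gaussian_ne_zero h
  have hτ := gaussian_div_im_pos h
  set τ := gaussian v / gaussian e with hτdef
  have him : 0 < (1 + d * τ).im := by
    have : (1 + d * τ).im = d * τ.im := by simp
    rw [this]; positivity
  have h10 : 1 + d * τ ≠ 0 := by intro h; rw [h] at him; simp at him
  have hmul : gaussian (e + d • v) = gaussian e * (1 + d * τ) := by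
    rw [hτdef]
    field_simp
    simp only [gaussian, Prod.fst_add, Prod.snd_add, Prod.smul_fst, Prod.smul_snd, smul_eq_mul]
    push_cast
    ring
  have he0' : gaussian (e + d • v) ≠ 0 := by rw [hmul]; exact mul_ne_zero he0 h10
  have a1 := arg_pos_lt_pi him
  have pi := Real.pi_pos
  have b1 := arg_le_pi (gaussian e)
  have b2 := neg_pi_lt_arg (gaussian e)
  have c1 := arg_le_pi (gaussian (e + d • v))
  have c2 := neg_pi_lt_arg (gaussian (e + d • v))
  have nonneg : ∀ x : ℤ × ℤ, 0 ≤ x.2 → 0 ≤ arg (gaussian x) := fun x hx => by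
    rw [arg_nonneg_iff, gaussian_im]; exact_mod_cast hx
  have neg : ∀ x : ℤ × ℤ, x.2 < 0 → arg (gaussian x) < 0 := fun x hx => by
    rw [arg_neg_iff, gaussian_im]; exact_mod_cast hx
  apply eq_add_of_exp_eq
  · split_ifs
    · rw [exp_sub, exp_add, exp_log he0, exp_log he0', exp_log h10, hmul]
      simp
    · rw [exp_sub, exp_add, exp_log he0, exp_log he0', exp_log h10, hmul]
      simp
  all_goals
    split_ifs with hc
    · have := nonneg e hc.1
      have := neg _ hc.2
      have e1 : (log (gaussian (e + d • v)) - (log (gaussian e) + log (1 + d * τ)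
          - 2 * Real.pi * I * (1 : ℤ))).im
          = arg (gaussian (e + d • v)) - (arg (gaussian e) + arg (1 + d * τ) - 2 * Real.pi) := by
        simp only [sub_im, add_im, log_im]
        simp
      rw [e1]
      linarith
    · have e1 : (log (gaussian (e + d • v)) - (log (gaussian e) + log (1 + d * τ)
          - 2 * Real.pi * I * (0 : ℤ))).im
          = arg (gaussian (e + d • v)) - (arg (gaussian e) + arg (1 + d * τ)) := by
        simp only [sub_im, add_im, log_im]
        simp
      rw [e1]
      rcases lt_or_ge e.2 0 with h1 | h1
      · have := neg e h1
        linarith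
      · have h2 : 0 ≤ (e + d • v).2 := by
          by_contra h2
          exact hc ⟨h1, not_le.1 h2⟩
        have := nonneg _ h1
        have := nonneg _ h2
        linarith

open Complex in
/-- **The number 12.** For a cyclic sequence of primitive vectors `e i` turning counterclockwise,
with lattice vectors `q i` at height one over both `e (i - 1)` and `e i`, the lengths of the
two dual loops add up to twelve times the winding number. -/
theorem sum_add_sum_eq_twelve {ι : Type*} [Fintype ι] (σ : Equiv.Perm ι) (e q : ι → ℤ × ℤ)
    (l d : ι → ℤ) (hdet : ∀ i, (q i).1 * (e i).2 - (q i).2 * (e i).1 = 1)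
    (hq : ∀ i, q (σ i) = q i + l i • e i) (he : ∀ i, e (σ i) = e i - d i • q (σ i))
    (hd : ∀ i, 1 ≤ d i) :
    ∑ i, l i + ∑ i, d i
      = 12 * ∑ i, (if 0 ≤ (e i).2 ∧ (e (σ i)).2 < 0 then 1 else 0 : ℤ) := by
  obtain ⟨L, hT, hS⟩ := exists_log_eta
  -- A logarithm of e¹² η(-q/e)⁻²⁴. The sign of `q` puts -q/e in the upper half-plane.
  let F : ℤ × ℤ → ℤ × ℤ → ℂ := fun e q => 12 * log (gaussian e) - 24 * L (-gaussian q / gaussian e)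
  have gneg : ∀ q, gaussian (-q) = -gaussian q := fun q => by simp [gaussian]; ring
  have key1 : ∀ i, F (e i) (q (σ i)) = F (e i) (q i) + 2 * Real.pi * I * l i := by
    intro i
    have hdet' : (e i).1 * (-q i).2 - (e i).2 * (-q i).1 = 1 := by
      have := hdet i
      simp only [Prod.snd_neg, Prod.fst_neg]
      linarith
    have h0 := gaussian_ne_zero hdet'
    have him := gaussian_div_im_pos hdet'
    rw [gneg] at him
    have h1 := logEta_add_int hT (-l i) _ him
    have h2 : -gaussian (q (σ i)) / gaussian (e i)
        = -gaussian (q i) / gaussian (e i) + ((-l i : ℤ) : ℂ) := by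
      rw [hq]
      field_simp
      simp only [gaussian, Prod.fst_add, Prod.snd_add, Prod.smul_fst, Prod.smul_snd, smul_eq_mul]
      push_cast
      ring
    simp only [F]
    rw [h2, h1]
    push_cast
    ring
  have key2 : ∀ i, F (e (σ i)) (q (σ i)) = F (e i) (q (σ i)) + 2 * Real.pi * I * (d i
      - 12 * (if 0 ≤ (e i).2 ∧ (e (σ i)).2 < 0 then 1 else 0 : ℤ) : ℤ) := by
    intro i
    have hdet' : (e i).1 * (-q (σ i)).2 - (e i).2 * (-q (σ i)).1 = 1 := by
      have := hdet i
      simp only [Prod.snd_neg, Prod.fst_neg, hq, Prod.fst_add, Prod.snd_add, Prod.smul_fst,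
        Prod.smul_snd, smul_eq_mul]
      linarith
    have h0 := gaussian_ne_zero hdet'
    have him := gaussian_div_im_pos hdet'
    have hes : e (σ i) = e i + d i • (-q (σ i)) := by rw [he]; simp [sub_eq_add_neg]
    have h1 := logEta_div_one_add hT hS (d i) (hd i) _ him
    have h2 := log_gaussian_add hdet' (hd i)
    rw [← hes, gneg] at h2
    rw [gneg] at h1
    have h3 : -gaussian (q (σ i)) / gaussian (e (σ i))
        = -gaussian (q (σ i)) / gaussian (e i)
          / (1 + d i * (-gaussian (q (σ i)) / gaussian (e i))) := by
      rw [div_div]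
      congr 1
      rw [mul_add, mul_one, mul_left_comm, mul_div_cancel₀ _ h0, hes]
      simp only [gaussian, Prod.fst_add, Prod.snd_add, Prod.smul_fst, Prod.smul_snd, smul_eq_mul,
        Prod.fst_neg, Prod.snd_neg]
      push_cast
      ring
    simp only [F]
    rw [h3, h2, h1]
    push_cast
    ring
  -- `σ` only permutes the terms, so the increments of `F` computed above sum to zero.
  have hsum : ∑ i, F (e (σ i)) (q (σ i)) = ∑ i, F (e i) (q i) :=
    Equiv.sum_comp σ (fun i => F (e i) (q i))
  have htot : ∑ i, (2 * Real.pi * I * l i + 2 * Real.pi * I * (d i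
      - 12 * (if 0 ≤ (e i).2 ∧ (e (σ i)).2 < 0 then 1 else 0 : ℤ) : ℤ)) = 0 := by
    rw [← sub_eq_zero.2 hsum, ← Finset.sum_sub_distrib]
    refine Finset.sum_congr rfl fun i _ => ?_
    rw [key2, key1]
    ring
  rw [Finset.sum_add_distrib, ← Finset.mul_sum, ← Finset.mul_sum, ← mul_add] at htot
  have hne : (2 * Real.pi * I : ℂ) ≠ 0 := two_pi_I_ne_zero
  have h3 := (mul_eq_zero.1 htot).resolve_left hne
  have h4 : ∑ i, l i + ∑ i, (d i
      - 12 * (if 0 ≤ (e i).2 ∧ (e (σ i)).2 < 0 then 1 else 0 : ℤ)) = 0 := by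
    exact_mod_cast h3
  rw [Finset.sum_sub_distrib, ← Finset.mul_sum] at h4
  linarith

/-! ### Cyclic indices and subsequences -/

lemma finRotate_val {n : ℕ} (i : Fin n) : (finRotate n i : ℕ) = (i + 1) % n := by
  cases n with
  | zero => exact i.elim0
  | succ n =>
    rw [coe_finRotate]
    split_ifs with h
    · subst h; simp
    · rw [Nat.mod_eq_of_lt]
      have := i.2
      have : (i : ℕ) ≠ n := fun h' => h (Fin.ext h')
      omega

/-- A predicate stable under the cyclic rotation holds everywhere or nowhere. -/
lemma finRotate_induction {n : ℕ} {P : Fin n → Prop} (h : ∀ i, P i → P (finRotate n i))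
    {i : Fin n} (hi : P i) (j : Fin n) : P j := by
  have key : ∀ t : ℕ, ∀ j : Fin n, (j : ℕ) = (i + t) % n → P j := by
    intro t
    induction t with
    | zero =>
      intro j hj
      rw [add_zero, Nat.mod_eq_of_lt i.2] at hj
      rwa [Fin.ext hj]
    | succ t ih =>
      intro j hj
      have hpos : 0 < n := i.pos
      have := h _ (ih ⟨(i + t) % n, Nat.mod_lt _ hpos⟩ rfl)
      convert this
      apply Fin.ext
      rw [finRotate_val, hj]
      simp [add_assoc]
  -- This many steps lead from `i` to `n + j`, without truncated subtraction.
  refine key (n - i + j) j ?_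
  have : (i : ℕ) + (n - i + j) = n + j := by have := i.2; omega
  rw [this, Nat.add_mod_left, Nat.mod_eq_of_lt j.2]

/-- Backward induction along the cycle, started from the indices in a nonempty set. -/
lemma finRotate_backward_induction {n : ℕ} {I : Set (Fin n)} (hI : I.Nonempty) {P : Fin n → Prop}
    (h1 : ∀ i ∈ I, P i) (h2 : ∀ i, i ∉ I → P (finRotate n i) → P i) (i : Fin n) : P i := by
  by_contra hi
  have := finRotate_induction (P := fun i => ¬ P i)
    (fun i hi hi' => hi (h2 i (fun hiI => hi (h1 i hiI)) hi')) hi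
  obtain ⟨j, hj⟩ := hI
  exact this j (h1 j hj)

/-- For a strictly increasing `k : Fin m → Fin n`, the map sending `i` to the index of the
cyclically first term of `k` at or after `i`. -/
lemma exists_cyclic_ceil {m n : ℕ} {k : Fin m → Fin n} (hk : StrictMono k) (hm : 0 < m) :
    ∃ r : Fin n → Fin m, (∀ j, r (k j) = j) ∧ (∀ i, i ∉ Set.range k → r i = r (finRotate n i)) ∧
      ∀ j, r (finRotate n (k j)) = finRotate m j := by
  classical
  -- `C i` counts the terms of `k` before `i`, so it is the index of the first term at or after `i`;
  -- the value `m`, when no term is left, wraps to 0.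
  let C : ℕ → ℕ := fun t => (Finset.univ.filter fun j : Fin m => (k j : ℕ) < t).card
  have hC0 : C 0 = 0 := by simp [C]
  have hCn : C n = m := by
    have : (Finset.univ.filter fun j : Fin m => (k j : ℕ) < n) = Finset.univ := by
      ext j; simp
    simp only [C, this, Finset.card_univ, Fintype.card_fin]
  have hCk : ∀ j, C (k j) = j := by
    intro j
    have : (Finset.univ.filter fun j' : Fin m => (k j' : ℕ) < k j) = Finset.Iio j := by
      ext j'
      simp [hk.lt_iff_lt]
    simp only [C, this, Fin.card_Iio]
  have hCk1 : ∀ j, C (k j + 1) = j + 1 := by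
    intro j
    have : (Finset.univ.filter fun j' : Fin m => (k j' : ℕ) < k j + 1) = Finset.Iic j := by
      ext j'
      simp [hk.le_iff_le]
    simp only [C, this, Fin.card_Iic]
  have hC1 : ∀ i : Fin n, i ∉ Set.range k → C (i + 1) = C i := by
    intro i hi
    simp only [C]
    congr 1
    ext j
    have : (k j : ℕ) ≠ i := fun h => hi ⟨j, Fin.ext h⟩
    simp only [Finset.mem_filter, Finset.mem_univ, true_and]
    omega
  have hrot : ∀ i : Fin n, C (finRotate n i) % m = C (i + 1) % m := by
    intro i
    rw [finRotate_val]
    have := i.2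
    rcases Nat.lt_or_ge (i + 1) n with h | h
    · rw [Nat.mod_eq_of_lt h]
    · have h' : (i : ℕ) + 1 = n := by omega
      rw [h', Nat.mod_self, hC0, hCn]
      simp
  refine ⟨fun i => ⟨C i % m, Nat.mod_lt _ hm⟩, fun j => ?_, fun i hi => ?_, fun j => ?_⟩
  · apply Fin.ext
    simp only
    rw [hCk, Nat.mod_eq_of_lt j.2]
  · apply Fin.ext
    simp only
    rw [hrot, hC1 i hi]
  · apply Fin.ext
    simp only
    rw [hrot, hCk1, finRotate_val]

lemma exists_strictMono_range_eq {n : ℕ} (I : Set (Fin n)) :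
    ∃ (m : ℕ) (k : Fin m → Fin n), StrictMono k ∧ Set.range k = I := by
  classical
  refine ⟨I.toFinset.card, I.toFinset.orderEmbOfFin rfl, (Finset.orderEmbOfFin _ _).strictMono, ?_⟩
  rw [Finset.range_orderEmbOfFin, Set.coe_toFinset]

lemma sum_comp_eq_of_support_subset {m n : ℕ} {M : Type*} [AddCommMonoid M] {k : Fin m → Fin n}
    (hk : Function.Injective k) (f : Fin n → M) (hf : ∀ i, i ∉ Set.range k → f i = 0) :
    ∑ j, f (k j) = ∑ i, f i := by
  classical
  rw [← Finset.sum_image (s := Finset.univ) (g := k) (f := f) (fun a _ b _ h => hk h)]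
  refine Finset.sum_subset (Finset.subset_univ _) fun i _ hi => hf i ?_
  simpa using hi

/-! ### Determinants and normal cones in the plane -/

lemma det₂_add_left (u v w : ℝ × ℝ) : det₂ (u + v) w = det₂ u w + det₂ v w := by
  simp only [det₂, Prod.fst_add, Prod.snd_add]; ring

lemma det₂_add_right (u v w : ℝ × ℝ) : det₂ u (v + w) = det₂ u v + det₂ u w := by
  simp only [det₂, Prod.fst_add, Prod.snd_add]; ring

lemma det₂_sub_left (u v w : ℝ × ℝ) : det₂ (u - v) w = det₂ u w - det₂ v w := by
  simp only [det₂, Prod.fst_sub, Prod.snd_sub]; ring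

lemma det₂_sub_right (u v w : ℝ × ℝ) : det₂ u (v - w) = det₂ u v - det₂ u w := by
  simp only [det₂, Prod.fst_sub, Prod.snd_sub]; ring

lemma det₂_smul_left (a : ℝ) (u v : ℝ × ℝ) : det₂ (a • u) v = a * det₂ u v := by
  simp only [det₂, Prod.smul_fst, Prod.smul_snd, smul_eq_mul]; ring

lemma det₂_smul_right (a : ℝ) (u v : ℝ × ℝ) : det₂ u (a • v) = a * det₂ u v := by
  simp only [det₂, Prod.smul_fst, Prod.smul_snd, smul_eq_mul]; ring

lemma det₂_self (u : ℝ × ℝ) : det₂ u u = 0 := by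
  simp only [det₂]; ring

lemma det₂_swap (u v : ℝ × ℝ) : det₂ u v = -det₂ v u := by
  simp only [det₂]; ring

/-- Cramer's rule without division. -/
lemma det₂_smul_eq (u v g : ℝ × ℝ) :
    det₂ u v • g = det₂ g v • u + det₂ u g • v := by
  ext <;> simp only [det₂, Prod.fst_add, Prod.snd_add, Prod.smul_fst, Prod.smul_snd, smul_eq_mul] <;>
    ring

lemma eq_of_det₂_ne_zero {u v : ℝ × ℝ} (h : det₂ u v ≠ 0) (g : ℝ × ℝ) :
    g = (det₂ g v / det₂ u v) • u + (det₂ u g / det₂ u v) • v := by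
  have := det₂_smul_eq u v g
  rw [← smul_right_inj h, this, smul_add, smul_smul, smul_smul, mul_div_cancel₀ _ h,
    mul_div_cancel₀ _ h]

lemma eq_zero_of_det₂_eq_zero {u v y : ℝ × ℝ} (h : det₂ u v ≠ 0) (hu : det₂ y u = 0)
    (hv : det₂ y v = 0) : y = 0 := by
  rw [eq_of_det₂_ne_zero h y, hv, det₂_swap u y, hu]
  simp

/-- A vector parallel to `u ≠ 0` is a multiple of it. -/
lemma exists_smul_of_det₂_eq_zero {u g : ℝ × ℝ} (hu : u ≠ 0) (h : det₂ u g = 0) :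
    ∃ t : ℝ, g = t • u := by
  have hnn : 0 < u.1 * u.1 + u.2 * u.2 := by
    by_contra hc
    push Not at hc
    have h1 : u.1 = 0 := by nlinarith [sq_nonneg u.1, sq_nonneg u.2]
    have h2 : u.2 = 0 := by nlinarith [sq_nonneg u.1, sq_nonneg u.2]
    exact hu (Prod.ext h1 h2)
  simp only [det₂] at h
  refine ⟨(g.1 * u.1 + g.2 * u.2) / (u.1 * u.1 + u.2 * u.2), ?_⟩
  ext
  · simp only [Prod.smul_fst, smul_eq_mul]
    rw [div_mul_eq_mul_div, eq_div_iff hnn.ne']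
    linear_combination -u.2 * h
  · simp only [Prod.smul_snd, smul_eq_mul]
    rw [div_mul_eq_mul_div, eq_div_iff hnn.ne']
    linear_combination u.1 * h

/-- Every linear functional on the plane is a determinant. -/
lemma exists_det₂_eq (f : ℝ × ℝ →L[ℝ] ℝ) : ∃ g : ℝ × ℝ, ∀ x, f x = det₂ x g := by
  refine ⟨(-f (0, 1), f (1, 0)), fun x => ?_⟩
  have : x = x.1 • ((1, 0) : ℝ × ℝ) + x.2 • ((0, 1) : ℝ × ℝ) := by ext <;> simp
  conv_lhs => rw [this, map_add, map_smul, map_smul]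
  simp only [det₂, smul_eq_mul]
  ring

/-- The linear functional `x ↦ det₂ x g`. -/
noncomputable def detLeft (g : ℝ × ℝ) : ℝ × ℝ →L[ℝ] ℝ :=
  g.2 • ContinuousLinearMap.fst ℝ ℝ ℝ - g.1 • ContinuousLinearMap.snd ℝ ℝ ℝ

@[simp] lemma detLeft_apply (g x : ℝ × ℝ) : detLeft g x = det₂ x g := by
  simp [detLeft, det₂]; ring

lemma det₂_le_of_mem_convexHull {A : Set (ℝ × ℝ)} {g : ℝ × ℝ} {c : ℝ}
    (h : ∀ x ∈ A, det₂ x g ≤ c) {x : ℝ × ℝ} (hx : x ∈ convexHull ℝ A) : det₂ x g ≤ c := by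
  have hconv : Convex ℝ {x | detLeft g x ≤ c} :=
    convex_halfSpace_le (detLeft g).toLinearMap.isLinear c
  have := convexHull_min (s := A) (t := {x | detLeft g x ≤ c}) (fun x hx => by
    simpa using h x hx) hconv hx
  simpa using this

lemma collinear_of_det₂_eq_zero {A : Set (ℝ × ℝ)} {p u : ℝ × ℝ} (hu : u ≠ 0)
    (h : ∀ x ∈ A, det₂ u (x - p) = 0) : Collinear ℝ A := by
  rw [collinear_iff_exists_forall_eq_smul_vadd]
  refine ⟨p, u, fun x hx => ?_⟩
  obtain ⟨t, ht⟩ := exists_smul_of_det₂_eq_zero hu (h x hx)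
  exact ⟨t, by rw [← ht]; simp⟩

/-- The normal cones of a cyclic sequence of points turning counterclockwise cover the plane. -/
lemma exists_normal_cone {n : ℕ} (hn : 0 < n) {p u : Fin n → ℝ × ℝ} {l : Fin n → ℝ}
    (hl : ∀ i, 0 < l i) (hstep : ∀ i, p (finRotate n i) = p i + l i • u i)
    (hturn : ∀ i, 0 < det₂ (u i) (u (finRotate n i))) (g : ℝ × ℝ) :
    ∃ (i : Fin n) (a b : ℝ), 0 ≤ a ∧ 0 ≤ b ∧ g = a • u i + b • u (finRotate n i) := by
  have : Nonempty (Fin n) := ⟨⟨0, hn⟩⟩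
  -- At a point maximal for `g`, neither neighbour is higher; by Cramer's rule these two
  -- inequalities are the signs of the coefficients.
  obtain ⟨j, hj⟩ := Finite.exists_max (fun i => det₂ (p i) g)
  obtain ⟨i, rfl⟩ := (finRotate n).surjective j
  refine ⟨i, det₂ g (u (finRotate n i)) / det₂ (u i) (u (finRotate n i)),
    det₂ (u i) g / det₂ (u i) (u (finRotate n i)), div_nonneg ?_ (hturn i).le,
    div_nonneg ?_ (hturn i).le, eq_of_det₂_ne_zero (hturn i).ne' g⟩
  · have := hj (finRotate n (finRotate n i))
    rw [hstep, det₂_add_left, det₂_smul_left] at this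
    rw [det₂_swap]
    have := hl (finRotate n i)
    nlinarith
  · have h1 := hj i
    rw [hstep, det₂_add_left, det₂_smul_left] at h1
    have := hl i
    nlinarith

/-- A functional `g` separating `x` from the hull lies in the cone of `u i` and its successor; the
bounds for these two add up to det(x, g) ≤ det(P_{i+1}, g), a contradiction. The points `P` need not
be distinct or in convex position, so relaxed polygons with degenerate edges are covered. -/
lemma mem_convexHull_of_det₂_le {n : ℕ} {u : Fin n → ℝ × ℝ}
    (hcone : ∀ g : ℝ × ℝ, ∃ (i : Fin n) (a b : ℝ),
      0 ≤ a ∧ 0 ≤ b ∧ g = a • u i + b • u (finRotate n i))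
    {P : Fin n → ℝ × ℝ} {x : ℝ × ℝ}
    (h1 : ∀ i, det₂ x (u i) ≤ det₂ (P (finRotate n i)) (u i))
    (h2 : ∀ i, det₂ x (u i) ≤ det₂ (P i) (u i)) : x ∈ convexHull ℝ (Set.range P) := by
  by_contra hx
  have hcl : IsClosed (convexHull ℝ (Set.range P)) := (Set.finite_range P).isClosed_convexHull (𝕜 := ℝ)
  obtain ⟨f, s, hs, hsx⟩ := geometric_hahn_banach_closed_point (convex_convexHull ℝ _) hcl hx
  obtain ⟨g, hg⟩ := exists_det₂_eq f
  obtain ⟨i, a, b, ha, hb, rfl⟩ := hcone g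
  have h3 := hs _ (subset_convexHull ℝ _ ⟨finRotate n i, rfl⟩)
  rw [hg, det₂_add_right, det₂_smul_right, det₂_smul_right] at h3 hsx
  have := mul_le_mul_of_nonneg_left (h1 i) ha
  have := mul_le_mul_of_nonneg_left (h2 (finRotate n i)) hb
  linarith

/-! ### Counterclockwise enumeration of the vertices -/

/-- If c - b = t(b - a), then t < 0 squeezes Γ into a line, t = 0 gives c = b, and t > 0 puts the
extreme point `b` inside the segment from `a` to `c`. -/
lemma det₂_pos_of_extremePoints {Γ : Set (ℝ × ℝ)} (hnc : ¬ Collinear ℝ Γ) {a b c : ℝ × ℝ}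
    (ha : a ∈ Γ) (hb : b ∈ Γ.extremePoints ℝ) (hc : c ∈ Γ) (hab : b ≠ a) (hbc : c ≠ b)
    (h1 : ∀ x ∈ Γ, 0 ≤ det₂ (b - a) (x - a)) (h2 : ∀ x ∈ Γ, 0 ≤ det₂ (c - b) (x - b)) :
    0 < det₂ (b - a) (c - b) := by
  have hu : b - a ≠ 0 := sub_ne_zero.2 hab
  have hnn : 0 ≤ det₂ (b - a) (c - b) := by
    have h := h1 c hc
    have : c - a = (b - a) + (c - b) := by abel
    rwa [this, det₂_add_right, det₂_self, zero_add] at h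
  refine lt_of_le_of_ne hnn fun h0 => ?_
  obtain ⟨t, ht⟩ := exists_smul_of_det₂_eq_zero hu h0.symm
  rcases lt_trichotomy t 0 with h | rfl | h
  · apply hnc
    refine collinear_of_det₂_eq_zero (p := a) hu fun x hx => ?_
    have h3 := h1 x hx
    have h4 := h2 x hx
    rw [ht, det₂_smul_left] at h4
    have h5 : x - a = (b - a) + (x - b) := by abel
    rw [h5, det₂_add_right, det₂_self, zero_add] at h3 ⊢
    nlinarith
  · rw [zero_smul, sub_eq_zero] at ht
    exact hbc ht
  · have hmem : b ∈ openSegment ℝ a c := by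
      refine ⟨t / (1 + t), 1 / (1 + t), by positivity, by positivity, by field_simp; ring, ?_⟩
      have hcb : c = b + t • (b - a) := by rw [← ht]; abel
      rw [hcb]
      have h1t : (1 + t) ≠ 0 := by positivity
      ext
      · simp only [Prod.fst_add, Prod.smul_fst, Prod.fst_sub, smul_eq_mul]
        field_simp; ring
      · simp only [Prod.snd_add, Prod.smul_snd, Prod.snd_sub, smul_eq_mul]
        field_simp; ring
    exact hab (hb.2 ha hc hmem).symm

/-- The vertex that follows `p` in counterclockwise order. -/
lemma exists_next_vertex {Γ E : Set (ℝ × ℝ)} (hE : E.Finite) (hΓ : Γ = convexHull ℝ E)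
    (hext : E = Γ.extremePoints ℝ) {p : ℝ × ℝ} (hp : p ∈ E) (hne : (E \ {p}).Nonempty) :
    ∃ x ∈ E, x ≠ p ∧ ∀ y ∈ Γ, 0 ≤ det₂ (x - p) (y - p) := by
  have hconvΓ : Convex ℝ Γ := hΓ ▸ convex_convexHull ℝ E
  have hpn : p ∉ convexHull ℝ (E \ {p}) := by
    have h := hext ▸ hp
    rw [hconvΓ.mem_extremePoints_iff_mem_sdiff_convexHull_sdiff] at h
    intro h'
    refine h.2 (convexHull_mono (Set.sdiff_subset_sdiff_left ?_) h')
    rw [hΓ]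
    exact subset_convexHull ℝ E
  have hfin : (E \ {p}).Finite := hE.subset Set.sdiff_subset
  obtain ⟨f, s, hs, hsp⟩ := geometric_hahn_banach_closed_point (convex_convexHull ℝ _)
    (hfin.isClosed_convexHull (𝕜 := ℝ)) hpn
  obtain ⟨h, hh⟩ := exists_det₂_eq f
  have hpos : ∀ y ∈ E \ {p}, 0 < det₂ h (y - p) := by
    intro y hy
    have := hs y (subset_convexHull ℝ _ hy)
    rw [hh] at this hsp
    rw [det₂_swap, det₂_sub_left]
    linarith
  have hh2 : 0 < h.1 ^ 2 + h.2 ^ 2 := by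
    obtain ⟨y, hy⟩ := hne
    have h1 := hpos y hy
    by_contra hc
    push Not at hc
    have e1 : h.1 = 0 := by nlinarith [sq_nonneg h.1, sq_nonneg h.2]
    have e2 : h.2 = 0 := by nlinarith [sq_nonneg h.1, sq_nonneg h.2]
    simp [det₂, e1, e2] at h1
  -- Seen from `p`, all other vertices lie strictly to the left of `h`. The quotient is the
  -- cotangent of the angle from `h`, so its maximum picks the smallest angle.
  obtain ⟨x, hx, hmax⟩ := Set.exists_max_image (E \ {p})
    (fun y => (h.1 * (y - p).1 + h.2 * (y - p).2) / det₂ h (y - p)) hfin hne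
  refine ⟨x, hx.1, hx.2, ?_⟩
  have hEy : ∀ y ∈ E, det₂ y (x - p) ≤ det₂ p (x - p) := by
    intro y hy
    by_cases hyp : y = p
    · rw [hyp]
    · have h1 := hmax y ⟨hy, hyp⟩
      have hxpos := hpos x hx
      have hypos := hpos y ⟨hy, hyp⟩
      rw [div_le_div_iff₀ hypos hxpos] at h1
      rw [← sub_nonpos, ← det₂_sub_left]
      have key : (h.1 ^ 2 + h.2 ^ 2) * det₂ (y - p) (x - p)
          = (h.1 * (y - p).1 + h.2 * (y - p).2) * det₂ h (x - p)
            - (h.1 * (x - p).1 + h.2 * (x - p).2) * det₂ h (y - p) := by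
        simp only [det₂]; ring
      by_contra hc
      push Not at hc
      have := mul_pos hh2 hc
      linarith
  intro y hy
  rw [hΓ] at hy
  have := det₂_le_of_mem_convexHull hEy hy
  rw [det₂_swap, det₂_sub_left]
  linarith

lemma collinear_convexHull_iff {A : Set (ℝ × ℝ)} :
    Collinear ℝ (convexHull ℝ A) ↔ Collinear ℝ A := by
  rw [Collinear, Collinear, ← direction_affineSpan, affineSpan_convexHull, direction_affineSpan]

lemma convexHull_extremePoints_of_finite {Γ A : Set (ℝ × ℝ)} (hA : A.Finite)
    (hΓ : Γ = convexHull ℝ A) :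
    (Γ.extremePoints ℝ).Finite ∧ convexHull ℝ (Γ.extremePoints ℝ) = Γ := by
  have hsub : Γ.extremePoints ℝ ⊆ A := by rw [hΓ]; exact extremePoints_convexHull_subset
  have hfin := hA.subset hsub
  refine ⟨hfin, ?_⟩
  have hc : IsCompact Γ := hΓ ▸ hA.isCompact_convexHull ℝ
  have hconv : Convex ℝ Γ := hΓ ▸ convex_convexHull ℝ A
  conv_rhs => rw [← closure_convexHull_extremePoints hc hconv]
  exact ((hfin.isClosed_convexHull ℝ).closure_eq).symm

lemma exists_mem_periodicPts {α : Type*} [Finite α] [Nonempty α] (f : α → α) :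
    ∃ x, x ∈ Function.periodicPts f := by
  obtain ⟨x⟩ := ‹Nonempty α›
  obtain ⟨i, j, hij, h⟩ := Finite.exists_ne_map_eq_of_infinite (fun i : ℕ => f^[i] x)
  wlog hlt : i < j generalizing i j
  · exact this j i hij.symm h.symm (by omega)
  refine ⟨f^[i] x, j - i, by omega, ?_⟩
  have : f^[j - i] (f^[i] x) = f^[j] x := by
    rw [← Function.iterate_add_apply]; congr 1; omega
  rw [Function.IsPeriodicPt, Function.IsFixedPt, this, h]

/-- Iterating the choice of a next vertex reaches a periodic orbit. This closed orbit always turns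
left, so its normal cones cover the plane and its hull is all of Γ; hence it contains every extreme
point. -/
theorem exists_counterclockwiseEnum {Γ A : Set (ℝ × ℝ)} (hA : A.Finite)
    (hΓ : Γ = convexHull ℝ A) (hnc : ¬ Collinear ℝ Γ) :
    ∃ (n : ℕ) (p : Fin n → ℝ × ℝ), IsCounterclockwiseEnum Γ p := by
  obtain ⟨hfin, hhull⟩ := convexHull_extremePoints_of_finite hA hΓ
  set E := Γ.extremePoints ℝ with hE
  have hEΓ : E ⊆ Γ := extremePoints_subset
  have hncE : ¬ Collinear ℝ E := by
    rwa [← collinear_convexHull_iff, hhull]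
  have hnext : ∀ p : E, ∃ x : E, (x : ℝ × ℝ) ≠ p ∧
      ∀ y ∈ Γ, 0 ≤ det₂ ((x : ℝ × ℝ) - p) (y - p) := by
    intro p
    have hne : (E \ {(p : ℝ × ℝ)}).Nonempty := by
      by_contra hc
      rw [Set.not_nonempty_iff_eq_empty, Set.sdiff_eq_empty] at hc
      exact hncE ((collinear_singleton ℝ (p : ℝ × ℝ)).subset hc)
    obtain ⟨x, hx, hxp, hxy⟩ := exists_next_vertex hfin hhull.symm hE p.2 hne
    exact ⟨⟨x, hx⟩, hxp, hxy⟩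
  choose f hfne hf using hnext
  have : Finite E := hfin
  have : Nonempty E := by
    by_contra hc
    rw [not_nonempty_iff, Set.isEmpty_coe_sort] at hc
    rw [hc] at hncE
    exact hncE (collinear_empty ℝ (ℝ × ℝ))
  obtain ⟨x₀, hx₀⟩ := exists_mem_periodicPts f
  set n := Function.minimalPeriod f x₀ with hn
  have hnpos : 0 < n := Function.minimalPeriod_pos_of_mem_periodicPts hx₀
  let p : Fin n → ℝ × ℝ := fun i => (f^[i] x₀ : E)
  have hp1 : ∀ i, p (finRotate n i) = (f (f^[i] x₀) : E) := by
    intro i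
    simp only [p]
    rw [finRotate_val, Function.iterate_mod_minimalPeriod_eq, Function.iterate_succ_apply']
  have hpE : ∀ i, p i ∈ E := fun i => (f^[i] x₀ : E).2
  have hleft : ∀ i, ∀ x ∈ Γ, 0 ≤ det₂ (p (finRotate n i) - p i) (x - p i) := by
    intro i
    rw [hp1]
    exact hf _
  have hne : ∀ i, p (finRotate n i) ≠ p i := by
    intro i
    rw [hp1]
    exact hfne _
  refine ⟨n, p, ?_, ?_, hleft⟩
  · intro i j hij
    have := Function.iterate_injOn_Iio_minimalPeriod (f := f) (x := x₀) i.2 j.2 (Subtype.ext hij)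
    exact Fin.ext this
  · refine subset_antisymm (Set.range_subset_iff.2 hpE) ?_
    have hturn : ∀ i, 0 < det₂ (p (finRotate n i) - p i)
        (p (finRotate n (finRotate n i)) - p (finRotate n i)) := fun i =>
      det₂_pos_of_extremePoints hnc (hEΓ (hpE i)) (hpE _) (hEΓ (hpE _)) (hne _) (hne _)
        (hleft _) (hleft _)
    have hcone := exists_normal_cone hnpos (p := p) (u := fun i => p (finRotate n i) - p i)
      (l := fun _ => 1) (fun _ => one_pos) (fun i => by simp) hturn
    have hsub : Γ ⊆ convexHull ℝ (Set.range p) := by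
      intro x hx
      refine mem_convexHull_of_det₂_le hcone (fun i => ?_) (fun i => ?_)
      · have h1 := hleft i x hx
        have h2 := det₂_self (p (finRotate n i) - p i)
        rw [det₂_sub_right] at h1 h2
        rw [det₂_swap x, det₂_swap (p _)]
        linarith
      · have h1 := hleft i x hx
        rw [det₂_sub_right] at h1
        rw [det₂_swap x, det₂_swap (p i)]
        linarith
    have hsup : convexHull ℝ (Set.range p) ⊆ Γ := by
      rw [← hhull]
      exact convexHull_mono (Set.range_subset_iff.2 hpE)
    have heq : Γ = convexHull ℝ (Set.range p) := subset_antisymm hsub hsup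
    intro x hx
    rw [heq] at hx
    exact extremePoints_convexHull_subset hx

/-! ### Edges of a lattice polygon -/

/-- The vertices `p`, the primitive edge vectors `e` and the lattice lengths `l` of the edges of
a lattice polygon `Γ`, in counterclockwise order. -/
structure EdgeData (Γ : Set (ℝ × ℝ)) {n : ℕ} (p : Fin n → ℝ × ℝ) (e : Fin n → ℤ × ℤ)
    (l : Fin n → ℤ) : Prop where
  pos : 0 < n
  hull : Γ = convexHull ℝ (Set.range p)
  inj : Function.Injective p
  lattice : ∀ i, p i ∈ Set.range toPlane
  prim : ∀ i, IsCoprime (e i).1 (e i).2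
  step : ∀ i, p (finRotate n i) = p i + (l i : ℝ) • toPlane (e i)
  lpos : ∀ i, 0 < l i
  turn : ∀ i, 0 < det₂ (toPlane (e i)) (toPlane (e (finRotate n i)))
  left : ∀ i, ∀ x ∈ Γ, det₂ x (toPlane (e i)) ≤ det₂ (p i) (toPlane (e i))

lemma exists_primitive {w : ℤ × ℤ} (hw : w ≠ 0) :
    ∃ (l : ℤ) (e : ℤ × ℤ), 0 < l ∧ IsCoprime e.1 e.2 ∧ w = l • e := by
  have h0 : w.1 ≠ 0 ∨ w.2 ≠ 0 := by
    by_contra hc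
    push Not at hc
    exact hw (Prod.ext hc.1 hc.2)
  have hg : 0 < Int.gcd w.1 w.2 := Int.gcd_pos_iff.2 h0
  refine ⟨Int.gcd w.1 w.2, (w.1 / Int.gcd w.1 w.2, w.2 / Int.gcd w.1 w.2), by exact_mod_cast hg,
    Int.isCoprime_iff_gcd_eq_one.2 (Int.gcd_ediv_gcd_ediv_gcd hg), ?_⟩
  ext
  · simp [Int.mul_ediv_cancel' (Int.gcd_dvd_left w.1 w.2)]
  · simp [Int.mul_ediv_cancel' (Int.gcd_dvd_right w.1 w.2)]

lemma toPlane_sub (v w : ℤ × ℤ) : toPlane (v - w) = toPlane v - toPlane w := by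
  ext <;> simp [toPlane]

lemma toPlane_add (v w : ℤ × ℤ) : toPlane (v + w) = toPlane v + toPlane w := by
  ext <;> simp [toPlane]

lemma toPlane_zsmul (a : ℤ) (v : ℤ × ℤ) : toPlane (a • v) = (a : ℝ) • toPlane v := by
  ext <;> simp [toPlane]

lemma toPlane_neg (v : ℤ × ℤ) : toPlane (-v) = -toPlane v := by
  ext <;> simp [toPlane]

lemma toPlane_zero : toPlane 0 = 0 := by
  ext <;> simp [toPlane]

lemma toPlane_injective : Function.Injective toPlane := by
  intro v w h
  have h1 := congrArg Prod.fst h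
  have h2 := congrArg Prod.snd h
  simp only [toPlane, Int.cast_inj] at h1 h2
  exact Prod.ext h1 h2

lemma det₂_toPlane (v w : ℤ × ℤ) :
    det₂ (toPlane v) (toPlane w) = ((v.1 * w.2 - v.2 * w.1 : ℤ) : ℝ) := by
  simp [det₂, toPlane]

theorem IsCounterclockwiseEnum.exists_edgeData {Γ A : Set (ℝ × ℝ)} (hA : A.Finite)
    (hAZ : A ⊆ Set.range toPlane) (hΓ : Γ = convexHull ℝ A) (hnc : ¬ Collinear ℝ Γ) {n : ℕ}
    {p : Fin n → ℝ × ℝ} (hp : IsCounterclockwiseEnum Γ p) : ∃ e l, EdgeData Γ p e l := by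
  obtain ⟨hfin, hhull⟩ := convexHull_extremePoints_of_finite hA hΓ
  obtain ⟨hinj, hrange, hleft⟩ := hp
  have hpE : ∀ i, p i ∈ Γ.extremePoints ℝ := fun i => hrange ▸ ⟨i, rfl⟩
  have hlat : ∀ i, p i ∈ Set.range toPlane := fun i => by
    apply hAZ
    have := hpE i
    rw [hΓ] at this
    exact extremePoints_convexHull_subset this
  have hhull' : Γ = convexHull ℝ (Set.range p) := by rw [hrange, hhull]
  have hncr : ¬ Collinear ℝ (Set.range p) := by
    rwa [← collinear_convexHull_iff, ← hhull']
  have hn : 2 ≤ n := by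
    by_contra hc
    apply hncr
    have : Subsingleton (Fin n) := by
      rw [Fin.subsingleton_iff_le_one]; omega
    exact (Set.subsingleton_range p).induction_on (collinear_empty ℝ _) (collinear_singleton ℝ)
  have hrot : ∀ i, finRotate n i ≠ i := by
    intro i h
    have h1 := congrArg Fin.val h
    rw [finRotate_val] at h1
    have := i.2
    rcases Nat.lt_or_ge (i + 1) n with h' | h'
    · rw [Nat.mod_eq_of_lt h'] at h1; omega
    · have h'' : (i : ℕ) + 1 = n := by omega
      rw [h'', Nat.mod_self] at h1; omega
  have hne : ∀ i, p (finRotate n i) ≠ p i := fun i h => hrot i (hinj h)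
  have hstep : ∀ i, ∃ (l : ℤ) (e : ℤ × ℤ), 0 < l ∧ IsCoprime e.1 e.2 ∧
      p (finRotate n i) - p i = (l : ℝ) • toPlane e := by
    intro i
    obtain ⟨a, ha⟩ := hlat i
    obtain ⟨b, hb⟩ := hlat (finRotate n i)
    have hba : b - a ≠ 0 := by
      rw [sub_ne_zero]
      rintro rfl
      exact hne i (hb.symm.trans ha)
    obtain ⟨l, e, hl, he, h⟩ := exists_primitive hba
    refine ⟨l, e, hl, he, ?_⟩
    rw [← ha, ← hb, ← toPlane_sub, h, toPlane_zsmul]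
  choose l e hl he hle using hstep
  refine ⟨e, l, by omega, hhull', hinj, hlat, he, fun i => ?_, hl, fun i => ?_, fun i x hx => ?_⟩
  · rw [← hle]; abel
  · have := det₂_pos_of_extremePoints hnc (hpE i).1 (hpE _) (hpE _).1 (hne i) (hne _)
      (hleft _) (hleft _)
    rw [hle, hle, det₂_smul_left, det₂_smul_right] at this
    have h1 : (0 : ℝ) < l i := by exact_mod_cast hl i
    have h2 : (0 : ℝ) < l (finRotate n i) := by exact_mod_cast hl _
    rw [← mul_assoc] at this
    exact (mul_pos_iff_of_pos_left (mul_pos h1 h2)).1 this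
  · have := hleft i x hx
    rw [hle, det₂_smul_left, mul_nonneg_iff_of_pos_left (by exact_mod_cast hl i),
      det₂_sub_right] at this
    rw [det₂_swap x, det₂_swap (p i)]
    linarith

lemma exists_eq_smul_of_isCoprime {e f : ℤ × ℤ} (he : IsCoprime e.1 e.2)
    (h : e.1 * f.2 - e.2 * f.1 = 0) : ∃ t : ℤ, f = t • e := by
  obtain ⟨a, b, hab⟩ := he
  refine ⟨a * f.1 + b * f.2, ?_⟩
  ext
  · simp only [Prod.smul_fst, smul_eq_mul]
    linear_combination (-f.1) * hab - b * h
  · simp only [Prod.smul_snd, smul_eq_mul]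
    linear_combination (-f.2) * hab + a * h

lemma eq_or_eq_neg_of_isCoprime {e f : ℤ × ℤ} (he : IsCoprime e.1 e.2) (hf : IsCoprime f.1 f.2)
    (h : e.1 * f.2 - e.2 * f.1 = 0) : f = e ∨ f = -e := by
  obtain ⟨t, rfl⟩ := exists_eq_smul_of_isCoprime he h
  have ht : IsUnit t := by
    obtain ⟨a, b, hab⟩ := hf
    simp only [Prod.smul_fst, Prod.smul_snd, smul_eq_mul] at hab
    exact IsUnit.of_mul_eq_one (a * e.1 + b * e.2) (by linear_combination hab)
  rcases Int.isUnit_iff.1 ht with rfl | rfl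
  · left; simp
  · right; simp

lemma exists_int_of_smul_toPlane {e z : ℤ × ℤ} (he : IsCoprime e.1 e.2) {t : ℝ}
    (h : toPlane z = t • toPlane e) : ∃ k : ℤ, t = k := by
  obtain ⟨a, b, hab⟩ := he
  refine ⟨a * z.1 + b * z.2, ?_⟩
  have h1 := congrArg Prod.fst h
  have h2 := congrArg Prod.snd h
  simp only [toPlane, Prod.smul_fst, Prod.smul_snd, smul_eq_mul] at h1 h2
  have hab' : (a : ℝ) * e.1 + b * e.2 = 1 := by exact_mod_cast hab
  push_cast
  rw [h1, h2]
  linear_combination (-t) * hab'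

lemma toPlane_ne_zero_of_isCoprime {e : ℤ × ℤ} (he : IsCoprime e.1 e.2) : toPlane e ≠ 0 := by
  intro h
  rw [← toPlane_zero] at h
  rw [toPlane_injective h] at he
  exact not_isCoprime_zero_zero he

namespace EdgeData

variable {Γ : Set (ℝ × ℝ)} {n : ℕ} {p : Fin n → ℝ × ℝ} {e : Fin n → ℤ × ℤ} {l : Fin n → ℤ}

lemma cone (D : EdgeData Γ p e l) (g : ℝ × ℝ) : ∃ (i : Fin n) (a b : ℝ), 0 ≤ a ∧ 0 ≤ b ∧
    g = a • toPlane (e i) + b • toPlane (e (finRotate n i)) :=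
  exists_normal_cone D.pos (u := fun i => toPlane (e i)) (l := fun i => (l i : ℝ))
    (fun i => by exact_mod_cast D.lpos i) D.step D.turn g

lemma edge_ne_zero (D : EdgeData Γ p e l) (i : Fin n) : toPlane (e i) ≠ 0 :=
  toPlane_ne_zero_of_isCoprime (D.prim i)

lemma lpos_real (D : EdgeData Γ p e l) (i : Fin n) : (0 : ℝ) < l i := by
  exact_mod_cast D.lpos i

lemma vertex_mem (D : EdgeData Γ p e l) (i : Fin n) : p i ∈ Γ := by
  rw [D.hull]; exact subset_convexHull ℝ _ ⟨i, rfl⟩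

lemma det₂_succ {P : Fin n → ℝ × ℝ} {l' : Fin n → ℤ}
    (hstep : ∀ i, P (finRotate n i) = P i + (l' i : ℝ) • toPlane (e i)) (i : Fin n) :
    det₂ (P (finRotate n i)) (toPlane (e i)) = det₂ (P i) (toPlane (e i)) := by
  rw [hstep, det₂_add_left, det₂_smul_left, det₂_self, mul_zero, add_zero]

lemma mem_of_det₂_le (D : EdgeData Γ p e l) {P : Fin n → ℝ × ℝ} {l' : Fin n → ℤ}
    (hstep : ∀ i, P (finRotate n i) = P i + (l' i : ℝ) • toPlane (e i)) {x : ℝ × ℝ}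
    (hx : ∀ i, det₂ x (toPlane (e i)) ≤ det₂ (P i) (toPlane (e i))) :
    x ∈ convexHull ℝ (Set.range P) :=
  mem_convexHull_of_det₂_le D.cone (fun i => by rw [det₂_succ hstep]; exact hx i) hx

lemma mem_iff (D : EdgeData Γ p e l) (x : ℝ × ℝ) :
    x ∈ Γ ↔ ∀ i, det₂ x (toPlane (e i)) ≤ det₂ (p i) (toPlane (e i)) :=
  ⟨fun hx i => D.left i x hx, fun h => by rw [D.hull]; exact D.mem_of_det₂_le D.step h⟩

/-- A functional in the interior of the normal cone of a vertex is maximal only there. -/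
lemma eq_vertex (D : EdgeData Γ p e l) {i : Fin n} {g x : ℝ × ℝ}
    (h1 : 0 < det₂ (toPlane (e i)) g) (h2 : det₂ (toPlane (e (finRotate n i))) g < 0)
    (hx : x ∈ Γ) (hxg : det₂ (p (finRotate n i)) g ≤ det₂ x g) : x = p (finRotate n i) := by
  have hD := D.turn i
  have ha : det₂ (x - p (finRotate n i)) (toPlane (e i)) ≤ 0 := by
    rw [det₂_sub_left, det₂_succ D.step]; linarith [D.left i x hx]
  have hb : det₂ (x - p (finRotate n i)) (toPlane (e (finRotate n i))) ≤ 0 := by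
    rw [det₂_sub_left]; linarith [D.left (finRotate n i) x hx]
  have hg : 0 ≤ det₂ (x - p (finRotate n i)) g := by rw [det₂_sub_left]; linarith
  have key := congrArg (fun z => det₂ z g) (det₂_smul_eq (toPlane (e i))
    (toPlane (e (finRotate n i))) (x - p (finRotate n i)))
  simp only [det₂_smul_left, det₂_add_left] at key
  rw [det₂_swap (toPlane (e i)) (x - p (finRotate n i))] at key
  set A := det₂ (x - p (finRotate n i)) (toPlane (e i))
  set B := det₂ (x - p (finRotate n i)) (toPlane (e (finRotate n i)))
  have k0 := mul_nonneg hD.le hg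
  have k1 := mul_nonneg_of_nonpos_of_nonpos ha h2.le
  have k2 := mul_nonneg (neg_nonneg.2 hb) h1.le
  have hB : B = 0 := by
    have : B * det₂ (toPlane (e i)) g = 0 := by linarith
    exact (mul_eq_zero.1 this).resolve_right h1.ne'
  have hA : A = 0 := by
    have : A * det₂ (toPlane (e (finRotate n i))) g = 0 := by linarith
    exact (mul_eq_zero.1 this).resolve_right h2.ne
  exact sub_eq_zero.1 (eq_zero_of_det₂_eq_zero hD.ne' hA hB)

lemma succ_ne (D : EdgeData Γ p e l) (i : Fin n) : p (finRotate n i) ≠ p i := by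
  rw [D.step]
  intro h
  have := add_eq_left.1 h
  rcases smul_eq_zero.1 this with h | h
  · exact (D.lpos_real i).ne' h
  · exact D.edge_ne_zero i h

/-- No edge direction lies strictly between two consecutive ones: its functional would be maximal at
a single vertex, whereas both ends of edge `j` attain the maximum. -/
lemma no_between (D : EdgeData Γ p e l) {i j : Fin n}
    (h1 : 0 < det₂ (toPlane (e i)) (toPlane (e j))) :
    0 ≤ det₂ (toPlane (e (finRotate n i))) (toPlane (e j)) := by
  by_contra h2
  push Not at h2
  have hi := D.left j _ (D.vertex_mem (finRotate n i))
  have e1 := D.eq_vertex h1 h2 (D.vertex_mem j) hi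
  have e2 := D.eq_vertex h1 h2 (D.vertex_mem (finRotate n j)) (by rwa [det₂_succ D.step])
  exact D.succ_ne j (e2.trans e1.symm)

lemma sum_smul_eq_zero (D : EdgeData Γ p e l) : ∑ i, (l i : ℝ) • toPlane (e i) = 0 := by
  have h : ∀ i, (l i : ℝ) • toPlane (e i) = p (finRotate n i) - p i := fun i => by
    rw [D.step]; abel
  simp_rw [h]
  rw [Finset.sum_sub_distrib, Equiv.sum_comp (finRotate n) p, sub_self]

lemma sum_mul_det₂_eq_zero (D : EdgeData Γ p e l) (x : ℝ × ℝ) :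
    ∑ i, (l i : ℝ) * det₂ x (toPlane (e i)) = 0 := by
  have h := congrArg (fun z => detLeft x z) D.sum_smul_eq_zero
  simp only [map_sum, map_smul, map_zero, detLeft_apply, smul_eq_mul] at h
  rw [← neg_eq_zero, ← Finset.sum_neg_distrib, ← h]
  refine Finset.sum_congr rfl fun i _ => ?_
  rw [det₂_swap x]; ring

/-- A polygon has an interior point. -/
lemma exists_strict (D : EdgeData Γ p e l) :
    ∃ y ∈ Γ, ∀ i, det₂ y (toPlane (e i)) < det₂ (p i) (toPlane (e i)) := by
  have hn : (0 : ℝ) < n := by exact_mod_cast D.pos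
  -- The centroid of the vertices works, since the end of the next edge is strictly inside for edge
  -- `i`.
  have key : ∀ i, det₂ ((n : ℝ)⁻¹ • ∑ j, p j) (toPlane (e i)) < det₂ (p i) (toPlane (e i)) := by
    intro i
    rw [det₂_smul_left, inv_mul_lt_iff₀ hn]
    have h1 : det₂ (∑ j, p j) (toPlane (e i)) = ∑ j, det₂ (p j) (toPlane (e i)) := by
      rw [← detLeft_apply, map_sum]; simp
    have h2 : (n : ℝ) * det₂ (p i) (toPlane (e i)) = ∑ _j : Fin n, det₂ (p i) (toPlane (e i)) := by
      simp
    rw [h1, h2]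
    refine Finset.sum_lt_sum (fun j _ => D.left i _ (D.vertex_mem j))
      ⟨finRotate n (finRotate n i), Finset.mem_univ _, ?_⟩
    rw [D.step, det₂_add_left, det₂_succ D.step, det₂_smul_left,
      det₂_swap (toPlane (e (finRotate n i)))]
    have := mul_pos (D.lpos_real (finRotate n i)) (D.turn i)
    linarith
  exact ⟨_, (D.mem_iff _).2 fun i => (key i).le, key⟩

/-- The points of a relaxed polygon on the line of one of its edges. -/
lemma exists_eq_add_smul (D : EdgeData Γ p e l) {P : Fin n → ℝ × ℝ} {l' : Fin n → ℤ}
    (hstep : ∀ i, P (finRotate n i) = P i + (l' i : ℝ) • toPlane (e i)) {x : ℝ × ℝ}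
    (hx : ∀ i, det₂ x (toPlane (e i)) ≤ det₂ (P i) (toPlane (e i))) {i : Fin n}
    (hi : det₂ x (toPlane (e i)) = det₂ (P i) (toPlane (e i))) :
    ∃ t : ℝ, 0 ≤ t ∧ t ≤ l' i ∧ x = P i + t • toPlane (e i) := by
  have h0 : det₂ (toPlane (e i)) (x - P i) = 0 := by
    rw [det₂_swap, det₂_sub_left, hi, sub_self, neg_zero]
  obtain ⟨t, ht⟩ := exists_smul_of_det₂_eq_zero (D.edge_ne_zero i) h0
  have hxt : x = P i + t • toPlane (e i) := by rw [← ht]; abel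
  refine ⟨t, ?_, ?_, hxt⟩
  -- The inequality of the preceding edge bounds `t` below, that of the following edge bounds it
  -- above.
  · obtain ⟨k, rfl⟩ := (finRotate n).surjective i
    have h1 := hx k
    rw [hxt, det₂_add_left, det₂_succ hstep, det₂_smul_left,
      det₂_swap (toPlane (e (finRotate n k)))] at h1
    have := D.turn k
    nlinarith
  · have h1 := hx (finRotate n i)
    rw [hxt, hstep, det₂_add_left, det₂_add_left, det₂_smul_left, det₂_smul_left] at h1
    have h2 : (t - l' i) * det₂ (toPlane (e i)) (toPlane (e (finRotate n i))) ≤ 0 := by linarith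
    have := D.turn i
    nlinarith

/-- Edges with equal directions lie on one supporting line, and each starting point is then ahead of
the other. -/
lemma edge_injective (D : EdgeData Γ p e l) : Function.Injective e := by
  intro i j hij
  have h1 : det₂ (p j) (toPlane (e i)) = det₂ (p i) (toPlane (e i)) := by
    refine le_antisymm (D.left i _ (D.vertex_mem j)) ?_
    rw [hij]
    exact D.left j _ (D.vertex_mem i)
  obtain ⟨t, ht, -, h2⟩ := D.exists_eq_add_smul D.step (D.left · _ (D.vertex_mem j)) h1
  have h1' : det₂ (p i) (toPlane (e j)) = det₂ (p j) (toPlane (e j)) := by rw [← hij, h1]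
  obtain ⟨s, hs, -, h3⟩ := D.exists_eq_add_smul D.step (D.left · _ (D.vertex_mem i)) h1'
  rw [h2, ← hij, add_assoc, ← add_smul] at h3
  rcases smul_eq_zero.1 (left_eq_add.1 h3) with h | h
  · have : t = 0 := by linarith
    apply D.inj
    rw [h2, this, zero_smul, add_zero]
  · exact absurd h (D.edge_ne_zero i)

/-- Two edges of a relaxed polygon with interior that meet and do not turn are equal. -/
lemma eq_of_det₂_eq_zero (D : EdgeData Γ p e l) {P : Fin n → ℝ × ℝ} {x y : ℝ × ℝ}
    (hy : ∀ i, det₂ y (toPlane (e i)) < det₂ (P i) (toPlane (e i))) {i j : Fin n}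
    (hi : det₂ x (toPlane (e i)) = det₂ (P i) (toPlane (e i)))
    (hj : det₂ x (toPlane (e j)) = det₂ (P j) (toPlane (e j)))
    (hij : det₂ (toPlane (e i)) (toPlane (e j)) = 0) : i = j := by
  rw [det₂_toPlane, Int.cast_eq_zero] at hij
  rcases eq_or_eq_neg_of_isCoprime (D.prim i) (D.prim j) hij with h | h
  · exact D.edge_injective h.symm
  · exfalso
    have h1 := hy i
    have h2 := hy j
    have hneg : ∀ z, det₂ z (toPlane (e j)) = -det₂ z (toPlane (e i)) := by
      intro z; rw [h, toPlane_neg]; simp [det₂]; ring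
    rw [← hi] at h1
    rw [← hj, hneg, hneg] at h2
    linarith

/-! ### Boundary lattice points -/

lemma mem_frontier_iff (D : EdgeData Γ p e l) {P : Fin n → ℝ × ℝ} {K : Set (ℝ × ℝ)}
    (hK : ∀ x, x ∈ K ↔ ∀ i, det₂ x (toPlane (e i)) ≤ det₂ (P i) (toPlane (e i))) (x : ℝ × ℝ) :
    x ∈ frontier K ↔ x ∈ K ∧ ∃ i, det₂ x (toPlane (e i)) = det₂ (P i) (toPlane (e i)) := by
  have hKeq : K = ⋂ i, detLeft (toPlane (e i)) ⁻¹' Set.Iic (det₂ (P i) (toPlane (e i))) := by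
    ext x; simp [hK]
  have hclosed : IsClosed K := by
    rw [hKeq]
    exact isClosed_iInter fun i => isClosed_Iic.preimage (detLeft _).continuous
  have hint : interior K
      = ⋂ i, detLeft (toPlane (e i)) ⁻¹' Set.Iio (det₂ (P i) (toPlane (e i))) := by
    rw [hKeq, interior_iInter_of_finite]
    refine Set.iInter_congr fun i => ?_
    have hsurj : Function.Surjective (detLeft (toPlane (e i))) := by
      refine LinearMap.surjective (f := (detLeft (toPlane (e i))).toLinearMap) ?_
      intro h0
      apply D.edge_ne_zero i
      have h1 := congrArg (fun f => f (1, 0)) h0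
      have h2 := congrArg (fun f => f (0, 1)) h0
      simp [det₂] at h1 h2
      exact Prod.ext h2 h1
    rw [← ((detLeft (toPlane (e i))).isOpenMap hsurj).preimage_interior_eq_interior_preimage
      (detLeft _).continuous, interior_Iic]
  rw [hclosed.frontier_eq, Set.mem_sdiff, hint, hK]
  refine and_congr_right fun hx => ?_
  simp only [Set.mem_iInter, Set.mem_preimage, Set.mem_Iio, detLeft_apply, not_forall, not_lt]
  exact exists_congr fun i => ⟨fun h => le_antisymm (hx i) h, fun h => h.ge⟩

/-- The number of boundary lattice points of a relaxed polygon is its lattice perimeter. -/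
theorem boundaryCount_eq (D : EdgeData Γ p e l) {P : Fin n → ℝ × ℝ} {l' : Fin n → ℤ}
    (hlat : ∀ i, P i ∈ Set.range toPlane) (hl' : ∀ i, 0 ≤ l' i)
    (hstep : ∀ i, P (finRotate n i) = P i + (l' i : ℝ) • toPlane (e i)) {K : Set (ℝ × ℝ)}
    (hK : ∀ x, x ∈ K ↔ ∀ i, det₂ x (toPlane (e i)) ≤ det₂ (P i) (toPlane (e i)))
    (hPK : ∀ i, P i ∈ K) {y : ℝ × ℝ}
    (hy : ∀ i, det₂ y (toPlane (e i)) < det₂ (P i) (toPlane (e i))) :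
    (boundaryCount K : ℤ) = ∑ i, l' i := by
  choose z hz using hlat
  -- Half-open edges: the end of an edge is left to a later edge, and an edge of length zero
  -- contributes nothing.
  let f : (Σ i : Fin n, Fin (l' i).toNat) → ℤ × ℤ := fun a => z a.1 + ((a.2 : ℕ) : ℤ) • e a.1
  have hf : ∀ a, toPlane (f a) = P a.1 + ((a.2 : ℕ) : ℝ) • toPlane (e a.1) := fun a => by
    simp only [f, toPlane_add, toPlane_zsmul, hz]; push_cast; rfl
  have htight : ∀ a, det₂ (toPlane (f a)) (toPlane (e a.1)) = det₂ (P a.1) (toPlane (e a.1)) := by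
    intro a
    rw [hf, det₂_add_left, det₂_smul_left, det₂_self, mul_zero, add_zero]
  have hlt : ∀ a : (Σ i : Fin n, Fin (l' i).toNat), ((a.2 : ℕ) : ℝ) < l' a.1 := by
    intro a
    have h1 : ((a.2 : ℕ) : ℤ) < l' a.1 := by have := a.2.2; omega
    exact_mod_cast h1
  have hinj : Function.Injective f := by
    intro a b hab
    -- The rest of edge `a` after the common point stays on the inner side of edge `b`; by symmetry
    -- the determinant vanishes.
    have hside : ∀ a b, f a = f b → det₂ (toPlane (e a.1)) (toPlane (e b.1)) ≤ 0 := by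
      intro a b hab
      have h1 := (hK _).1 (hPK (finRotate n a.1)) b.1
      rw [← htight b, ← hab, hf, hstep, det₂_add_left, det₂_add_left, det₂_smul_left,
        det₂_smul_left] at h1
      have h2 : (l' a.1 - ((a.2 : ℕ) : ℝ)) * det₂ (toPlane (e a.1)) (toPlane (e b.1)) ≤ 0 := by
        linarith
      have := hlt a
      nlinarith
    have h1 := hside a b hab
    have h2 := hside b a hab.symm
    rw [det₂_swap] at h2
    have hab1 : a.1 = b.1 := D.eq_of_det₂_eq_zero hy (htight a) (hab ▸ htight b) (by linarith)
    obtain ⟨i, s⟩ := a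
    obtain ⟨j, t⟩ := b
    simp only at hab1
    subst hab1
    have h3 := congrArg toPlane hab
    rw [hf, hf] at h3
    have h4 := smul_left_injective ℝ (D.edge_ne_zero i) (add_left_cancel h3)
    have h5 : (s : ℕ) = t := by exact_mod_cast h4
    rw [Fin.ext h5]
  have hrange : {v : ℤ × ℤ | toPlane v ∈ frontier K} = Set.range f := by
    ext v
    simp only [Set.mem_ofPred_eq, Set.mem_range, D.mem_frontier_iff hK]
    constructor
    · rintro ⟨hv, i, hi⟩
      by_contra hc
      -- A tight point missed by all half-open edges is the end of its edge, hence tight for the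
      -- next edge and so for all. As ∑ l_i e_i = 0, no point can be tight everywhere while `y` is
      -- strict everywhere.
      have hnext : ∀ i, det₂ (toPlane v) (toPlane (e i)) = det₂ (P i) (toPlane (e i)) →
          det₂ (toPlane v) (toPlane (e (finRotate n i)))
            = det₂ (P (finRotate n i)) (toPlane (e (finRotate n i))) := by
        intro i hi
        obtain ⟨t, ht0, ht1, ht⟩ := D.exists_eq_add_smul hstep ((hK _).1 hv) hi
        have h1 : toPlane (v - z i) = t • toPlane (e i) := by
          rw [toPlane_sub, ht, hz]; abel
        obtain ⟨k, rfl⟩ := exists_int_of_smul_toPlane (D.prim i) h1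
        have hk0 : 0 ≤ k := by exact_mod_cast ht0
        have hk1 : k ≤ l' i := by exact_mod_cast ht1
        rcases lt_or_eq_of_le hk1 with h | h
        · refine absurd ⟨⟨i, ⟨k.toNat, by omega⟩⟩, ?_⟩ hc
          apply toPlane_injective
          rw [hf, ht]
          have : ((k.toNat : ℕ) : ℝ) = (k : ℝ) := by
            have := Int.toNat_of_nonneg hk0
            exact_mod_cast this
          simp only [this]
        · rw [ht, h, ← hstep]
      have hall := finRotate_induction hnext hi
      have h1 := D.sum_mul_det₂_eq_zero (toPlane v)
      have h2 := D.sum_mul_det₂_eq_zero y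
      have h3 : ∑ i, (l i : ℝ) * det₂ y (toPlane (e i))
          < ∑ i, (l i : ℝ) * det₂ (toPlane v) (toPlane (e i)) := by
        refine Finset.sum_lt_sum_of_nonempty ⟨i, Finset.mem_univ i⟩ fun j _ => ?_
        rw [hall j]
        exact mul_lt_mul_of_pos_left (hy j) (D.lpos_real j)
      linarith
    · rintro ⟨a, rfl⟩
      refine ⟨?_, a.1, htight a⟩
      rw [hK]
      intro j
      have h1 := (hK _).1 (hPK a.1) j
      have h2 := (hK _).1 (hPK (finRotate n a.1)) j
      rw [hstep, det₂_add_left, det₂_smul_left] at h2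
      rw [hf, det₂_add_left, det₂_smul_left]
      have h3 := hlt a
      have h4 : (0 : ℝ) ≤ ((a.2 : ℕ) : ℝ) := by positivity
      rcases le_or_gt (det₂ (toPlane (e a.1)) (toPlane (e j))) 0 with h | h <;> nlinarith
  rw [boundaryCount, hrange, ← Set.image_univ, Set.ncard_image_of_injective _ hinj, Set.ncard_univ,
    Nat.card_eq_fintype_card, Fintype.card_sigma]
  push_cast
  refine Finset.sum_congr rfl fun i _ => ?_
  rw [Fintype.card_fin, Int.toNat_of_nonneg (hl' i)]

end EdgeData

/-! ### Interior points, facets and relaxed vertices -/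

lemma exists_det₂_gt_of_mem_interior {Δ : Set (ℝ × ℝ)} {p g : ℝ × ℝ} (hp : p ∈ interior Δ)
    (hg : g ≠ 0) : ∃ x ∈ Δ, det₂ p g < det₂ x g := by
  have hpos : 0 < g.1 ^ 2 + g.2 ^ 2 := by
    by_contra hc
    push Not at hc
    have e1 : g.1 = 0 := by nlinarith [sq_nonneg g.1, sq_nonneg g.2]
    have e2 : g.2 = 0 := by nlinarith [sq_nonneg g.1, sq_nonneg g.2]
    exact hg (Prod.ext e1 e2)
  have hcont : Continuous fun t : ℝ => p + t • ((g.2, -g.1) : ℝ × ℝ) := by fun_prop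
  have hnhds : ∀ᶠ t in nhds (0 : ℝ), p + t • ((g.2, -g.1) : ℝ × ℝ) ∈ Δ := by
    apply hcont.continuousAt.eventually_mem
    rw [zero_smul, add_zero]
    exact mem_interior_iff_mem_nhds.1 hp
  obtain ⟨t, ht, htpos⟩ := ((hnhds.filter_mono nhdsWithin_le_nhds).and
    (self_mem_nhdsWithin (s := Set.Ioi (0 : ℝ)))).exists
  refine ⟨_, ht, ?_⟩
  rw [det₂_add_left, det₂_smul_left]
  have : det₂ ((g.2, -g.1) : ℝ × ℝ) g = g.1 ^ 2 + g.2 ^ 2 := by simp only [det₂]; ring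
  rw [this]
  have := mul_pos (Set.mem_Ioi.1 htpos) hpos
  linarith

lemma exists_mem_det₂_gt_of_mem_interior {A : Set (ℝ × ℝ)} {p g : ℝ × ℝ}
    (hp : p ∈ interior (convexHull ℝ A)) (hg : g ≠ 0) : ∃ x ∈ A, det₂ p g < det₂ x g := by
  obtain ⟨x, hx, hlt⟩ := exists_det₂_gt_of_mem_interior hp hg
  by_contra hc
  push Not at hc
  exact absurd (det₂_le_of_mem_convexHull hc hx) (not_le.2 hlt)

lemma finite_lattice_of_isBounded {B : Set (ℝ × ℝ)} (hB : Bornology.IsBounded B) :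
    {z : ℤ × ℤ | toPlane z ∈ B}.Finite := by
  obtain ⟨R, hR⟩ := hB.exists_norm_le
  refine (Set.finite_Icc ((-⌈R⌉, -⌈R⌉) : ℤ × ℤ) (⌈R⌉, ⌈R⌉)).subset fun z hz => ?_
  have h := hR _ hz
  have h1 : |(z.1 : ℝ)| ≤ R := (norm_fst_le (toPlane z)).trans h
  have h2 : |(z.2 : ℝ)| ≤ R := (norm_snd_le (toPlane z)).trans h
  rw [abs_le] at h1 h2
  have hc := Int.le_ceil R
  have a1 : (z.1 : ℝ) ≤ (⌈R⌉ : ℤ) := by linarith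
  have a2 : (z.2 : ℝ) ≤ (⌈R⌉ : ℤ) := by linarith
  have a3 : ((-⌈R⌉ : ℤ) : ℝ) ≤ z.1 := by push_cast; linarith
  have a4 : ((-⌈R⌉ : ℤ) : ℝ) ≤ z.2 := by push_cast; linarith
  exact ⟨⟨by exact_mod_cast a3, by exact_mod_cast a4⟩, ⟨by exact_mod_cast a1, by exact_mod_cast a2⟩⟩

lemma interiorPolytope_subset_interior {Δ : Set (ℝ × ℝ)} (hΔ : Convex ℝ Δ) :
    interiorPolytope Δ ⊆ interior Δ :=
  convexHull_min (by rintro _ ⟨z, hz, rfl⟩; exact hz) hΔ.interior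

lemma linForm_eq_det₂ (a : ℤ × ℤ) (x : ℝ × ℝ) : linForm a x = det₂ x (toPlane (-a.2, a.1)) := by
  simp [linForm, det₂, toPlane]; ring

/-- The outer conormal vector of an edge in direction `e`. -/
def conormal (e : ℤ × ℤ) : ℤ × ℤ := (e.2, -e.1)

lemma linForm_conormal (e : ℤ × ℤ) (x : ℝ × ℝ) : linForm (conormal e) x = det₂ x (toPlane e) := by
  simp [linForm_eq_det₂, conormal]

lemma isCoprime_conormal {e : ℤ × ℤ} (he : IsCoprime e.1 e.2) :
    IsCoprime (conormal e).1 (conormal e).2 := by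
  simp only [conormal]
  exact he.symm.neg_right

namespace EdgeData

variable {Γ : Set (ℝ × ℝ)} {n : ℕ} {p : Fin n → ℝ × ℝ} {e : Fin n → ℤ × ℤ} {l : Fin n → ℤ}

lemma exists_int_det₂ (D : EdgeData Γ p e l) (i : Fin n) (f : ℤ × ℤ) :
    ∃ b : ℤ, det₂ (p i) (toPlane f) = b := by
  obtain ⟨z, hz⟩ := D.lattice i
  exact ⟨_, by rw [← hz, det₂_toPlane]⟩

/-- The facets of a relaxed polygon. -/
lemma isFacetInequality (D : EdgeData Γ p e l) {K : Set (ℝ × ℝ)} {P : Fin n → ℝ × ℝ}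
    {l' : Fin n → ℤ} (hstep : ∀ i, P (finRotate n i) = P i + (l' i : ℝ) • toPlane (e i))
    (hK : ∀ x ∈ K, ∀ i, det₂ x (toPlane (e i)) ≤ det₂ (P i) (toPlane (e i)))
    (hPK : ∀ i, P i ∈ K) {i : Fin n} (hi : 0 < l' i) {b : ℤ}
    (hb : det₂ (P i) (toPlane (e i)) = b) : IsFacetInequality K (conormal (e i)) b := by
  refine ⟨isCoprime_conormal (D.prim i), fun x hx => ?_, P i, ⟨hPK i, ?_⟩, P (finRotate n i),
    ⟨hPK _, ?_⟩, ?_⟩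
  · rw [linForm_conormal, ← hb]; exact hK x hx i
  · rw [linForm_conormal, ← hb]
  · rw [linForm_conormal, ← hb, det₂_succ hstep]
  · rw [hstep]
    intro h
    rcases smul_eq_zero.1 (left_eq_add.1 h) with h | h
    · have : l' i = 0 := by exact_mod_cast h
      omega
    · exact D.edge_ne_zero i h

/-- A facet functional lies in some normal cone. Inside the cone its maximum is a single vertex,
against having two points of equality; on a boundary ray, primitivity makes it the edge vector. -/
lemma exists_of_isFacetInequality (D : EdgeData Γ p e l) {a : ℤ × ℤ} {b : ℤ}
    (h : IsFacetInequality Γ a b) :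
    ∃ i, a = conormal (e i) ∧ det₂ (p i) (toPlane (e i)) = b := by
  obtain ⟨hcop, hle, hnt⟩ := h
  set f : ℤ × ℤ := (-a.2, a.1) with hf
  have hfcop : IsCoprime f.1 f.2 := hcop.symm.neg_left
  simp only [linForm_eq_det₂, ← hf] at hle hnt
  obtain ⟨i, s, t, hs, ht, hg⟩ := D.cone (toPlane f)
  have hle' : ∀ x ∈ Γ, det₂ x (toPlane f) ≤ det₂ (p (finRotate n i)) (toPlane f) := by
    intro x hx
    rw [hg]
    simp only [det₂_add_right, det₂_smul_right]
    rw [det₂_succ D.step]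
    have := mul_le_mul_of_nonneg_left (D.left i x hx) hs
    have := mul_le_mul_of_nonneg_left (D.left (finRotate n i) x hx) ht
    linarith
  have hb : det₂ (p (finRotate n i)) (toPlane f) = b := by
    obtain ⟨x, hx, hxb⟩ := hnt.nonempty
    refine le_antisymm (hle _ (D.vertex_mem _)) ?_
    rw [← hxb]
    exact hle' x hx
  have hfe : ∀ j (c : ℝ), 0 ≤ c → toPlane f = c • toPlane (e j) → f = e j := by
    intro j c hc hfc
    have h0 : det₂ (toPlane (e j)) (toPlane f) = 0 := by
      rw [hfc, det₂_smul_right, det₂_self, mul_zero]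
    rw [det₂_toPlane, Int.cast_eq_zero] at h0
    rcases eq_or_eq_neg_of_isCoprime (D.prim j) hfcop h0 with h | h
    · exact h
    · exfalso
      rw [h, toPlane_neg] at hfc
      have : (c + 1) • toPlane (e j) = 0 := by
        rw [add_smul, ← hfc, one_smul]; simp
      rcases smul_eq_zero.1 this with h | h
      · linarith
      · exact D.edge_ne_zero j h
  have ha : ∀ j, f = e j → a = conormal (e j) := by
    intro j hj
    rw [← hj, hf]; simp [conormal]
  rcases hs.eq_or_lt with rfl | hs
  · rw [zero_smul, zero_add] at hg
    have := hfe _ t ht hg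
    exact ⟨_, ha _ this, by rw [← this, hb]⟩
  · rcases ht.eq_or_lt with rfl | ht
    · rw [zero_smul, add_zero] at hg
      have := hfe _ s hs.le hg
      exact ⟨_, ha _ this, by rw [← det₂_succ D.step, ← this, hb]⟩
    · exfalso
      have h1 : 0 < det₂ (toPlane (e i)) (toPlane f) := by
        rw [hg, det₂_add_right, det₂_smul_right, det₂_smul_right, det₂_self, mul_zero, zero_add]
        exact mul_pos ht (D.turn i)
      have h2 : det₂ (toPlane (e (finRotate n i))) (toPlane f) < 0 := by
        rw [hg, det₂_add_right, det₂_smul_right, det₂_smul_right, det₂_self, mul_zero, add_zero,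
          det₂_swap, mul_neg, neg_lt_zero]
        exact mul_pos hs (D.turn i)
      obtain ⟨x, ⟨hx, hxb⟩, y, ⟨hy, hyb⟩, hxy⟩ := hnt
      apply hxy
      rw [D.eq_vertex h1 h2 hx (by rw [hb, hxb]), D.eq_vertex h1 h2 hy (by rw [hb, hyb])]

/-- Only the two edges meeting at a vertex are facets through it: for another such facet, the
neighbouring vertices would place its direction strictly between two consecutive edge directions. -/
lemma isRelaxedVertex_iff (D : EdgeData Γ p e l) (i : Fin n) (p' : ℝ × ℝ) :
    IsRelaxedVertex Γ (p (finRotate n i)) p' ↔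
      det₂ (p' - p (finRotate n i)) (toPlane (e i)) = 1 ∧
      det₂ (p' - p (finRotate n i)) (toPlane (e (finRotate n i))) = 1 := by
  have hfacet : ∀ i b, det₂ (p i) (toPlane (e i)) = (b : ℤ) →
      IsFacetInequality Γ (conormal (e i)) b := fun i b hb =>
    D.isFacetInequality D.step (fun x hx i => D.left i x hx) D.vertex_mem (D.lpos i) hb
  constructor
  · intro h
    constructor
    · obtain ⟨b, hb⟩ := D.exists_int_det₂ i (e i)
      have := h _ _ (hfacet i b hb) (by rw [linForm_conormal, det₂_succ D.step, hb])
      rw [linForm_conormal] at this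
      rw [det₂_sub_left, det₂_succ D.step, this, hb]; ring
    · obtain ⟨b, hb⟩ := D.exists_int_det₂ (finRotate n i) (e (finRotate n i))
      have := h _ _ (hfacet _ b hb) (by rw [linForm_conormal, hb])
      rw [linForm_conormal] at this
      rw [det₂_sub_left, this, hb]; ring
  · rintro ⟨h1, h2⟩ a b hab hpb
    obtain ⟨j, rfl, hb⟩ := D.exists_of_isFacetInequality hab
    rw [linForm_conormal] at hpb ⊢
    obtain ⟨y, -, hy⟩ := D.exists_strict
    have key : i = j ∨ finRotate n i = j := by
      have h3 : 0 ≤ det₂ (toPlane (e i)) (toPlane (e j)) := by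
        have := D.left j _ (D.vertex_mem i)
        rw [hb, ← hpb, D.step, det₂_add_left, det₂_smul_left] at this
        have := D.lpos_real i
        nlinarith
      rcases h3.eq_or_lt with h3 | h3
      · exact Or.inl (D.eq_of_det₂_eq_zero hy (det₂_succ D.step i) (hpb.trans hb.symm) h3.symm)
      · right
        refine D.eq_of_det₂_eq_zero hy rfl (hpb.trans hb.symm) (le_antisymm ?_ (D.no_between h3))
        have := D.left j _ (D.vertex_mem (finRotate n (finRotate n i)))
        rw [hb, ← hpb, D.step, det₂_add_left, det₂_smul_left] at this
        have := D.lpos_real (finRotate n i)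
        nlinarith
    rcases key with rfl | rfl
    · rw [det₂_sub_left, hpb] at h1; linarith
    · rw [det₂_sub_left, hpb] at h2; linarith

end EdgeData

/-! ### The relaxation of the interior polygon -/

lemma exists_det_eq_one {e : ℤ × ℤ} (he : IsCoprime e.1 e.2) :
    ∃ u : ℤ × ℤ, u.1 * e.2 - u.2 * e.1 = 1 := by
  obtain ⟨a, b, h⟩ := he
  exact ⟨(b, -a), by simp only; linear_combination h⟩

namespace EdgeData

variable {Δ : Set (ℝ × ℝ)} {S : Finset (ℤ × ℤ)} {n : ℕ} {p : Fin n → ℝ × ℝ} {e : Fin n → ℤ × ℤ}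
  {l : Fin n → ℤ}

lemma mem_of_mem_interior (z : ℤ × ℤ) (hz : toPlane z ∈ interior Δ) :
    toPlane z ∈ interiorPolytope Δ :=
  subset_convexHull ℝ _ ⟨z, hz, rfl⟩

/-- A lattice polygon lies in the relaxation of its interior polygon. -/
lemma det₂_le_add_one (hΔ : Δ = convexHull ℝ (toPlane '' (S : Set (ℤ × ℤ))))
    (D : EdgeData (interiorPolytope Δ) p e l) (i : Fin n) {x : ℝ × ℝ} (hx : x ∈ Δ) :
    det₂ x (toPlane (e i)) ≤ det₂ (p i) (toPlane (e i)) + 1 := by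
  have hconv : Convex ℝ Δ := hΔ ▸ convex_convexHull ℝ _
  rw [hΔ] at hx
  refine det₂_le_of_mem_convexHull ?_ hx
  rintro _ ⟨z, hz, rfl⟩
  have hzΔ : toPlane z ∈ Δ := by rw [hΔ]; exact subset_convexHull ℝ _ ⟨z, hz, rfl⟩
  obtain ⟨a, ha⟩ := D.lattice i
  by_contra hc
  push Not at hc
  rw [← ha, det₂_toPlane, det₂_toPlane] at hc
  obtain ⟨u, hu⟩ := exists_det_eq_one (D.prim i)
  -- If `z` had height h ≥ 2 over edge `i`, the triangle from that edge to `z` would contain an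
  -- interior lattice point of Δ at height one, outside Δ⁽¹⁾.
  set h : ℤ := (z.1 * (e i).2 - z.2 * (e i).1) - (a.1 * (e i).2 - a.2 * (e i).1) with hh
  have hh2 : 1 < h := by
    have : a.1 * (e i).2 - a.2 * (e i).1 + 1 < z.1 * (e i).2 - z.2 * (e i).1 := by exact_mod_cast hc
    omega
  obtain ⟨k, hk⟩ := exists_eq_smul_of_isCoprime (D.prim i) (f := z - a - h • u) (by
    simp only [Prod.fst_sub, Prod.snd_sub, Prod.smul_fst, Prod.smul_snd, smul_eq_mul]
    rw [hh]
    linear_combination ((z.1 * (e i).2 - z.2 * (e i).1) - (a.1 * (e i).2 - a.2 * (e i).1)) * hu)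
  -- `m` is k/h rounded up and r = hm - k lies in [0, h - 1]. With s = r/(h - 1) ∈ [0, 1], the point
  -- at offset `s` on the edge, mixed with `z` in weights 1 - 1/h and 1/h, is the lattice point a +
  -- u + m e_i.
  set m : ℤ := -((-k) / h)
  set r : ℤ := (-k) % h
  have hr0 : 0 ≤ r := Int.emod_nonneg _ (by omega)
  have hrh : r < h := Int.emod_lt_of_pos _ (by omega)
  have hrm : k + r = h * m := by
    have h1 := Int.mul_ediv_add_emod (-k) h
    have h2 : h * m = -(h * ((-k) / h)) := by rw [← mul_neg]
    have h3 : r = (-k) % h := rfl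
    omega
  have hh1 : (0 : ℝ) < (h : ℝ) - 1 := by
    have : (1 : ℝ) < h := by exact_mod_cast hh2
    linarith
  have hh0 : (0 : ℝ) < h := by linarith
  set s : ℝ := r / (h - 1) with hs
  have hs0 : 0 ≤ s := div_nonneg (by exact_mod_cast hr0) hh1.le
  have hs1 : s ≤ 1 := by
    rw [hs, div_le_one hh1]
    have : r ≤ h - 1 := by omega
    exact_mod_cast this
  have hl1 : (1 : ℝ) ≤ l i := by exact_mod_cast D.lpos i
  have hmid : p i + s • toPlane (e i) ∈ interior Δ := by
    apply interiorPolytope_subset_interior hconv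
    have h1 := (convex_convexHull ℝ (toPlane '' interiorLatticePoints Δ)).add_smul_mem
      (D.vertex_mem i) (D.step i ▸ D.vertex_mem (finRotate n i)) (t := s / l i)
      ⟨by positivity, by rw [div_le_one (by linarith)]; linarith⟩
    rw [smul_smul, div_mul_cancel₀ _ (by linarith)] at h1
    exact h1
  have hy : toPlane (a + u + m • e i) ∈ interior Δ := by
    have h1 := hconv.combo_interior_self_mem_interior hmid hzΔ (a := 1 - 1 / h) (b := 1 / h)
      (by rw [sub_pos, div_lt_one hh0]; linarith) (by positivity) (by ring)
    convert h1 using 1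
    have hz : z = a + h • u + k • e i := by rw [← hk]; abel
    have hrm' : (k : ℝ) + r = h * m := by exact_mod_cast hrm
    have hm : (m : ℝ) = (k + r) / h := by rw [hrm']; field_simp
    rw [hz, ← ha]
    simp only [toPlane_add, toPlane_zsmul, hm, hs]
    ext
    · simp only [Prod.fst_add, Prod.smul_fst, smul_eq_mul]; field_simp; ring
    · simp only [Prod.snd_add, Prod.smul_snd, smul_eq_mul]; field_simp; ring
  have h1 := D.left i _ (mem_of_mem_interior _ hy)
  rw [toPlane_add, toPlane_add, toPlane_zsmul, det₂_add_left, det₂_add_left, det₂_smul_left,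
    det₂_self, ha, det₂_toPlane, hu] at h1
  norm_num at h1

/-- Every relaxed edge contains a lattice point of the polygon. -/
lemma exists_level_one (hΔ : Δ = convexHull ℝ (toPlane '' (S : Set (ℤ × ℤ))))
    (D : EdgeData (interiorPolytope Δ) p e l) (i : Fin n) :
    ∃ z ∈ S, det₂ (toPlane z) (toPlane (e i)) = det₂ (p i) (toPlane (e i)) + 1 := by
  have hconv : Convex ℝ Δ := hΔ ▸ convex_convexHull ℝ _
  have hp := interiorPolytope_subset_interior hconv (D.vertex_mem i)
  rw [hΔ] at hp
  obtain ⟨_, ⟨z, hz, rfl⟩, hlt⟩ := exists_mem_det₂_gt_of_mem_interior hp (D.edge_ne_zero i)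
  refine ⟨z, hz, le_antisymm (det₂_le_add_one hΔ D i ?_) ?_⟩
  · rw [hΔ]; exact subset_convexHull ℝ _ ⟨z, hz, rfl⟩
  · obtain ⟨a, ha⟩ := D.lattice i
    rw [← ha, det₂_toPlane, det₂_toPlane] at hlt ⊢
    exact_mod_cast hlt

/-- The relaxed vertices are lattice points. -/
lemma exists_relaxed_vertex (hΔ : Δ = convexHull ℝ (toPlane '' (S : Set (ℤ × ℤ))))
    (D : EdgeData (interiorPolytope Δ) p e l) (i : Fin n) :
    ∃ q : ℤ × ℤ, q.1 * (e i).2 - q.2 * (e i).1 = 1 ∧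
      q.1 * (e (finRotate n i)).2 - q.2 * (e (finRotate n i)).1 = 1 := by
  have hconv : Convex ℝ Δ := hΔ ▸ convex_convexHull ℝ _
  set j := finRotate n i with hj
  have hp := interiorPolytope_subset_interior hconv (D.vertex_mem j)
  rw [hΔ] at hp
  have hne : toPlane (e i) + toPlane (e j) ≠ 0 := by
    intro h
    have h1 := D.turn i
    rw [← hj, eq_neg_of_add_eq_zero_right h] at h1
    simp [det₂] at h1
    linarith
  -- The heights of `s` over the two edges are integers at most 1 with positive sum: (1, 1), (1, 0)
  -- or (0, 1).
  obtain ⟨_, ⟨s, hs, rfl⟩, hlt⟩ := exists_mem_det₂_gt_of_mem_interior hp hne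
  have hsΔ : toPlane s ∈ Δ := by rw [hΔ]; exact subset_convexHull ℝ _ ⟨s, hs, rfl⟩
  have h1 := det₂_le_add_one hΔ D i hsΔ
  have h2 := det₂_le_add_one hΔ D j hsΔ
  rw [← det₂_succ D.step] at h1
  obtain ⟨a, ha⟩ := D.lattice j
  rw [← hj, ← ha] at h1
  rw [← ha] at h2 hlt
  rw [← toPlane_add, det₂_toPlane, det₂_toPlane] at hlt
  rw [det₂_toPlane, det₂_toPlane] at h1 h2
  norm_cast at h1 h2 hlt
  simp only [Prod.fst_add, Prod.snd_add] at hlt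
  set x : ℤ × ℤ := s - a with hx
  have e1 : s.1 = x.1 + a.1 := by simp [hx]
  have e2 : s.2 = x.2 + a.2 := by simp [hx]
  rw [e1, e2] at h1 h2 hlt
  have k1 : x.1 * (e i).2 - x.2 * (e i).1 ≤ 1 := by linarith
  have k2 : x.1 * (e j).2 - x.2 * (e j).1 ≤ 1 := by linarith
  have k3 : 0 < (x.1 * (e i).2 - x.2 * (e i).1) + (x.1 * (e j).2 - x.2 * (e j).1) := by linarith
  -- Given `x` with heights (1, 0), a vector of height one over `g` is corrected by a multiple of
  -- `x` to height one over `f`.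
  have fix : ∀ (f g x : ℤ × ℤ), IsCoprime g.1 g.2 → x.1 * f.2 - x.2 * f.1 = 1 →
      x.1 * g.2 - x.2 * g.1 = 0 → ∃ q : ℤ × ℤ, q.1 * f.2 - q.2 * f.1 = 1 ∧
        q.1 * g.2 - q.2 * g.1 = 1 := by
    intro f g x hg hf h0
    obtain ⟨u, hu⟩ := exists_det_eq_one hg
    refine ⟨u + (1 - (u.1 * f.2 - u.2 * f.1)) • x, ?_, ?_⟩ <;>
      simp only [Prod.fst_add, Prod.snd_add, Prod.smul_fst, Prod.smul_snd, smul_eq_mul]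
    · linear_combination (1 - (u.1 * f.2 - u.2 * f.1)) * hf
    · linear_combination hu + (1 - (u.1 * f.2 - u.2 * f.1)) * h0
  rcases lt_or_eq_of_le k1 with k1' | k1'
  · obtain ⟨q, hq1, hq2⟩ := fix (e j) (e i) x (D.prim i) (by omega) (by omega)
    exact ⟨q, hq2, hq1⟩
  · rcases lt_or_eq_of_le k2 with k2' | k2'
    · exact fix (e i) (e j) x (D.prim j) k1' (by omega)
    · exact ⟨x, k1', k2'⟩

end EdgeData

/-- Lattice vectors `q i` at height one over the edges `i - 1` and `i`, the lengths `L i` of the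
moves from `q i` to the next one, and the lengths `d i` of the dual moves. -/
structure RelaxData {n : ℕ} (e q : Fin n → ℤ × ℤ) (L d : Fin n → ℤ) : Prop where
  height : ∀ i, (q i).1 * (e i).2 - (q i).2 * (e i).1 = 1
  move : ∀ i, q (finRotate n i) = q i + L i • e i
  dual : ∀ i, e (finRotate n i) = e i - d i • q (finRotate n i)
  dpos : ∀ i, 1 ≤ d i

namespace RelaxData

variable {n : ℕ} {e q : Fin n → ℤ × ℤ} {L d : Fin n → ℤ}

lemma height' (R : RelaxData e q L d) (i : Fin n) : det₂ (toPlane (q i)) (toPlane (e i)) = 1 := by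
  rw [det₂_toPlane, R.height, Int.cast_one]

lemma height_succ (R : RelaxData e q L d) (i : Fin n) :
    det₂ (toPlane (q (finRotate n i))) (toPlane (e i)) = 1 := by
  rw [R.move, toPlane_add, toPlane_zsmul, det₂_add_left, det₂_smul_left, det₂_self, R.height',
    mul_zero, add_zero]

lemma det₂_add (R : RelaxData e q L d) (x : ℝ × ℝ) (i : Fin n) :
    det₂ (x + toPlane (q i)) (toPlane (e i)) = det₂ x (toPlane (e i)) + 1 := by
  rw [det₂_add_left, R.height']

lemma det₂_dual (R : RelaxData e q L d) (i : Fin n) :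
    det₂ (toPlane (e i)) (toPlane (e (finRotate n i))) = d i := by
  rw [R.dual, toPlane_sub, toPlane_zsmul, det₂_sub_right, det₂_smul_right, det₂_self,
    det₂_swap, R.height_succ]
  ring

end RelaxData

namespace EdgeData

variable {Δ : Set (ℝ × ℝ)} {S : Finset (ℤ × ℤ)} {n : ℕ} {p : Fin n → ℝ × ℝ} {e : Fin n → ℤ × ℤ}
  {l : Fin n → ℤ}

/-- Consecutive `q` both have height one over the edge between them, so they differ by a multiple of
it; dually, consecutive `e` have the same determinant with the `q` they share. -/
lemma exists_relaxData (hΔ : Δ = convexHull ℝ (toPlane '' (S : Set (ℤ × ℤ))))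
    (D : EdgeData (interiorPolytope Δ) p e l) : ∃ q L d, RelaxData e q L d := by
  choose q' h1 h2 using exists_relaxed_vertex hΔ D
  set q : Fin n → ℤ × ℤ := fun i => q' ((finRotate n).symm i) with hq
  have hqs : ∀ i, q (finRotate n i) = q' i := fun i => congrArg q' ((finRotate n).symm_apply_apply i)
  have hq1 : ∀ i, (q i).1 * (e i).2 - (q i).2 * (e i).1 = 1 := by
    intro i
    obtain ⟨k, rfl⟩ := (finRotate n).surjective i
    rw [hqs]; exact h2 k
  have hL : ∀ i, ∃ L : ℤ, q (finRotate n i) = q i + L • e i := by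
    intro i
    obtain ⟨t, ht⟩ := exists_eq_smul_of_isCoprime (D.prim i) (f := q (finRotate n i) - q i) (by
      simp only [Prod.fst_sub, Prod.snd_sub]
      have := h1 i
      rw [← hqs] at this
      linear_combination hq1 i - this)
    exact ⟨t, by rw [← ht]; abel⟩
  choose L hL using hL
  have hdual : ∀ i, e (finRotate n i) = e i - ((e i).1 * (e (finRotate n i)).2
      - (e i).2 * (e (finRotate n i)).1) • q (finRotate n i) := by
    intro i
    have k1 := h1 i
    have k2 := h2 i
    rw [← hqs] at k1 k2
    ext
    · simp only [Prod.fst_sub, Prod.smul_fst, smul_eq_mul]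
      linear_combination (e i).1 * k2 - (e (finRotate n i)).1 * k1
    · simp only [Prod.snd_sub, Prod.smul_snd, smul_eq_mul]
      linear_combination (e i).2 * k2 - (e (finRotate n i)).2 * k1
  refine ⟨q, L, _, hq1, hL, hdual, fun i => ?_⟩
  have := D.turn i
  rw [det₂_toPlane] at this
  have : 0 < (e i).1 * (e (finRotate n i)).2 - (e i).2 * (e (finRotate n i)).1 := by
    exact_mod_cast this
  omega

lemma relax_step (D : EdgeData (interiorPolytope Δ) p e l) {q : Fin n → ℤ × ℤ} {L d : Fin n → ℤ}
    (R : RelaxData e q L d) (i : Fin n) :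
    p (finRotate n i) + toPlane (q (finRotate n i))
      = p i + toPlane (q i) + ((l i + L i : ℤ) : ℝ) • toPlane (e i) := by
  rw [D.step, R.move, toPlane_add, toPlane_zsmul]
  push_cast
  rw [add_smul]
  abel

/-- Δ meets each relaxed edge; this keeps l_i + L_i from being negative. -/
lemma exists_tight (hΔ : Δ = convexHull ℝ (toPlane '' (S : Set (ℤ × ℤ))))
    (D : EdgeData (interiorPolytope Δ) p e l) {q : Fin n → ℤ × ℤ} {L d : Fin n → ℤ}
    (R : RelaxData e q L d) (i : Fin n) :
    ∃ (t : ℝ), 0 ≤ t ∧ t ≤ (l i + L i : ℤ) ∧ p i + toPlane (q i) + t • toPlane (e i) ∈ Δ := by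
  obtain ⟨z, hz, hzi⟩ := exists_level_one hΔ D i
  have hzΔ : toPlane z ∈ Δ := by rw [hΔ]; exact subset_convexHull ℝ _ ⟨z, hz, rfl⟩
  obtain ⟨t, h0, h1, h2⟩ := D.exists_eq_add_smul (P := fun i => p i + toPlane (q i))
    (D.relax_step R) (x := toPlane z)
    (fun j => by rw [R.det₂_add]; exact det₂_le_add_one hΔ D j hzΔ)
    (by rw [R.det₂_add]; exact hzi)
  exact ⟨t, h0, h1, h2 ▸ hzΔ⟩

lemma relax_length_nonneg (hΔ : Δ = convexHull ℝ (toPlane '' (S : Set (ℤ × ℤ))))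
    (D : EdgeData (interiorPolytope Δ) p e l) {q : Fin n → ℤ × ℤ} {L d : Fin n → ℤ}
    (R : RelaxData e q L d) (i : Fin n) : 0 ≤ l i + L i := by
  obtain ⟨t, h0, h1, -⟩ := exists_tight hΔ D R i
  have : (0 : ℝ) ≤ (l i + L i : ℤ) := h0.trans h1
  exact_mod_cast this

/-- The relaxed vertices satisfy all relaxed inequalities. -/
lemma relaxed_vertex_le (hΔ : Δ = convexHull ℝ (toPlane '' (S : Set (ℤ × ℤ))))
    (D : EdgeData (interiorPolytope Δ) p e l) {q : Fin n → ℤ × ℤ} {L d : Fin n → ℤ}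
    (R : RelaxData e q L d) (i j : Fin n) :
    det₂ (p i + toPlane (q i)) (toPlane (e j)) ≤ det₂ (p j) (toPlane (e j)) + 1 := by
  obtain ⟨k, rfl⟩ := (finRotate n).surjective i
  -- The relaxed vertex is compared with a point of Δ on the relaxed edge before it or after it,
  -- whichever has the larger height over edge `j`.
  rcases le_or_gt (det₂ (toPlane (e k)) (toPlane (e j))) 0 with h | h
  · obtain ⟨t, -, ht, hmem⟩ := exists_tight hΔ D R k
    have h1 := det₂_le_add_one hΔ D j hmem
    rw [D.relax_step R, det₂_add_left, det₂_smul_left]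
    rw [det₂_add_left, det₂_smul_left] at h1
    have := mul_nonneg_of_nonpos_of_nonpos (sub_nonpos.2 ht) h
    linarith
  · have h' := D.no_between h
    obtain ⟨t, ht, -, hmem⟩ := exists_tight hΔ D R (finRotate n k)
    have h1 := det₂_le_add_one hΔ D j hmem
    rw [det₂_add_left, det₂_smul_left] at h1
    have := mul_nonneg ht h'
    linarith

/-- A maximal lattice polygon is the relaxation of its interior polygon. -/
theorem mem_iff_of_isMaximal (hΔ : Δ = convexHull ℝ (toPlane '' (S : Set (ℤ × ℤ))))
    (hmax : IsMaximalPolytope Δ) (D : EdgeData (interiorPolytope Δ) p e l) {q : Fin n → ℤ × ℤ}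
    {L d : Fin n → ℤ} (R : RelaxData e q L d) :
    (∀ x, x ∈ Δ ↔ ∀ i, det₂ x (toPlane (e i)) ≤ det₂ (p i + toPlane (q i)) (toPlane (e i))) ∧
      ∀ i, p i + toPlane (q i) ∈ Δ := by
  have hconv : Convex ℝ Δ := hΔ ▸ convex_convexHull ℝ _
  set P : Fin n → ℝ × ℝ := fun i => p i + toPlane (q i) with hP
  set K : Set (ℝ × ℝ) :=
    {x | ∀ i, det₂ x (toPlane (e i)) ≤ det₂ (P i) (toPlane (e i))} with hK
  have hKP : K ⊆ convexHull ℝ (Set.range P) := fun x hx => D.mem_of_det₂_le (D.relax_step R) hx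
  have hΔK : Δ ⊆ K := fun x hx i => by
    rw [hP, R.det₂_add]; exact det₂_le_add_one hΔ D i hx
  have hPK : ∀ i, P i ∈ K := fun i j => by
    have := relaxed_vertex_le hΔ D R i j
    rwa [← R.det₂_add (p j) j] at this
  have hbdd : Bornology.IsBounded K :=
    (isBounded_convexHull.2 (Set.finite_range P).isBounded).subset hKP
  have hfin := finite_lattice_of_isBounded hbdd
  set T := hfin.toFinset with hT
  -- The competitor for maximality: the hull of all lattice points of the relaxation.
  set Δ' := convexHull ℝ (toPlane '' (T : Set (ℤ × ℤ))) with hΔ'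
  have hTK : toPlane '' (T : Set (ℤ × ℤ)) ⊆ K := by
    rintro _ ⟨z, hz, rfl⟩
    simpa [hT] using hz
  have hΔ'K : ∀ x ∈ Δ', ∀ i, det₂ x (toPlane (e i)) ≤ det₂ (P i) (toPlane (e i)) :=
    fun x hx i => det₂_le_of_mem_convexHull (fun y hy => hTK hy i) hx
  have hsub : Δ ⊆ Δ' := by
    rw [hΔ]
    refine convexHull_mono (Set.image_mono fun z hz => ?_)
    simp only [hT, Set.Finite.coe_toFinset]
    exact hΔK (by rw [hΔ]; exact subset_convexHull ℝ _ ⟨z, hz, rfl⟩)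
  -- An interior lattice point satisfies the relaxed inequalities strictly, hence by integrality the
  -- original ones, and Δ⁽¹⁾ is inside the interior of Δ.
  have hinter : interiorLatticePoints Δ' = interiorLatticePoints Δ := by
    refine subset_antisymm (fun z hz => ?_) fun z hz => interior_mono hsub hz
    apply interiorPolytope_subset_interior hconv
    rw [D.mem_iff]
    intro i
    obtain ⟨x, hx, hlt⟩ := exists_det₂_gt_of_mem_interior hz (D.edge_ne_zero i)
    have h1 := hΔ'K x hx i
    rw [hP, R.det₂_add] at h1
    have h2 : det₂ (toPlane z) (toPlane (e i)) < det₂ (p i) (toPlane (e i)) + 1 := by linarith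
    obtain ⟨a, ha⟩ := D.lattice i
    rw [← ha, det₂_toPlane, det₂_toPlane] at h2 ⊢
    have h3 := Int.lt_add_one_iff.1 (by exact_mod_cast h2)
    exact_mod_cast h3
  have heq : Δ = Δ' := by
    by_contra hne
    exact hmax Δ' ⟨T, rfl⟩ (hsub.ssubset_of_ne hne) hinter
  have hPΔ : ∀ i, P i ∈ Δ := by
    intro i
    rw [heq]
    apply subset_convexHull
    obtain ⟨a, ha⟩ := D.lattice i
    refine ⟨a + q i, ?_, by rw [toPlane_add, ha]⟩
    simp only [hT, Set.Finite.coe_toFinset, Set.mem_ofPred_eq]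
    rw [toPlane_add, ha]
    exact hPK i
  refine ⟨fun x => ⟨fun hx => hΔK hx, fun hx => ?_⟩, hPΔ⟩
  exact convexHull_min (Set.range_subset_iff.2 hPΔ) hconv (hKP hx)

end EdgeData

/-! ### Winding number and column vectors -/

namespace EdgeData

variable {Γ : Set (ℝ × ℝ)} {n : ℕ} {p : Fin n → ℝ × ℝ} {e : Fin n → ℤ × ℤ} {l : Fin n → ℤ}

lemma snd_sum_eq_zero (D : EdgeData Γ p e l) : ∑ i, l i * (e i).2 = 0 := by
  have h := congrArg Prod.snd D.sum_smul_eq_zero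
  simp only [Prod.snd_sum, Prod.smul_snd, toPlane, smul_eq_mul, Prod.snd_zero] at h
  exact_mod_cast h

/-- Exactly one vertex of a polygon is the highest one, the leftmost if there are two. -/
lemma sum_top_eq_one (D : EdgeData Γ p e l) :
    ∑ i, (if 0 ≤ (e i).2 ∧ (e (finRotate n i)).2 < 0 then 1 else 0 : ℤ) = 1 := by
  have hne : (Finset.univ : Finset (Fin n)).Nonempty := ⟨⟨0, D.pos⟩, Finset.mem_univ _⟩
  -- Otherwise the second coordinates are all nonnegative or all negative, which ∑ l_i e_i = 0 and
  -- the turning exclude.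
  have hex : ∃ i, 0 ≤ (e i).2 ∧ (e (finRotate n i)).2 < 0 := by
    by_contra hc
    push Not at hc
    by_cases h0 : ∃ i, 0 ≤ (e i).2
    · obtain ⟨i, hi⟩ := h0
      have hall := finRotate_induction (P := fun i => 0 ≤ (e i).2) hc hi
      have hz := (Finset.sum_eq_zero_iff_of_nonneg
        (fun i _ => mul_nonneg (D.lpos i).le (hall i))).1 D.snd_sum_eq_zero
      have hz' : ∀ i, (e i).2 = 0 := fun i =>
        (mul_eq_zero.1 (hz i (Finset.mem_univ i))).resolve_left (D.lpos i).ne'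
      have := D.turn i
      rw [det₂_toPlane, hz', hz'] at this
      simp at this
    · push Not at h0
      have := Finset.sum_neg (fun i _ => mul_neg_of_pos_of_neg (D.lpos i) (h0 i)) hne
      rw [D.snd_sum_eq_zero] at this
      exact lt_irrefl _ this
  have htop : ∀ i, 0 ≤ (e i).2 → (e (finRotate n i)).2 < 0 → ∀ x ∈ Γ,
      x.2 ≤ (p (finRotate n i)).2 := by
    intro i h1 h2 x hx
    have hD := D.turn i
    have k1 := D.left i x hx
    rw [← det₂_succ D.step] at k1
    have k2 := D.left (finRotate n i) x hx
    have h1' : (0 : ℝ) ≤ (e i).2 := by exact_mod_cast h1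
    have h2' : ((e (finRotate n i)).2 : ℝ) < 0 := by exact_mod_cast h2
    have m1 := mul_le_mul_of_nonneg_left k1 (neg_nonneg.2 h2'.le)
    have m2 := mul_le_mul_of_nonneg_left k2 h1'
    simp only [det₂, toPlane] at hD m1 m2
    by_contra hc
    push Not at hc
    have := mul_pos hD (sub_pos.2 hc)
    linarith
  have hside : ∀ i j, 0 ≤ (e i).2 → (e (finRotate n i)).2 < 0 → 0 ≤ (e j).2 →
      (e (finRotate n j)).2 < 0 → (p (finRotate n i)).1 ≤ (p (finRotate n j)).1 := by
    intro i j hi1 hi2 hj1 hj2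
    have h1 := htop i hi1 hi2 _ (D.vertex_mem (finRotate n j))
    have h2 := htop j hj1 hj2 _ (D.vertex_mem (finRotate n i))
    have h3 := D.left (finRotate n i) _ (D.vertex_mem (finRotate n j))
    have h4 : (p (finRotate n i)).2 = (p (finRotate n j)).2 := le_antisymm h2 h1
    simp only [det₂, toPlane] at h3
    rw [h4] at h3
    have h2' : ((e (finRotate n i)).2 : ℝ) < 0 := by exact_mod_cast hi2
    nlinarith
  obtain ⟨i, hi1, hi2⟩ := hex
  rw [Finset.sum_eq_single i]
  · rw [if_pos ⟨hi1, hi2⟩]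
  · rintro j - hji
    rw [if_neg]
    rintro ⟨hj1, hj2⟩
    apply hji
    apply (finRotate n).injective
    apply D.inj
    exact Prod.ext (le_antisymm (hside j i hj1 hj2 hi1 hi2) (hside i j hi1 hi2 hj1 hj2))
      (le_antisymm (htop i hi1 hi2 _ (D.vertex_mem _)) (htop j hj1 hj2 _ (D.vertex_mem _)))
  · intro h
    exact absurd (Finset.mem_univ i) h

lemma sum_add_sum_eq_twelve (D : EdgeData Γ p e l) {q : Fin n → ℤ × ℤ} {L d : Fin n → ℤ}
    (R : RelaxData e q L d) : ∑ i, L i + ∑ i, d i = 12 := by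
  rw [_root_.sum_add_sum_eq_twelve (finRotate n) e q L d R.height R.move R.dual R.dpos,
    D.sum_top_eq_one, mul_one]

/-- The vectors strictly inside the move over an edge only leave the polygon through it. -/
lemma column_le (D : EdgeData Γ p e l) {q : Fin n → ℤ × ℤ} {L d : Fin n → ℤ}
    (R : RelaxData e q L d) {i j : Fin n} (hij : j ≠ i) {s : ℤ} (hs : 1 ≤ s) (hsL : s + 1 ≤ L i) :
    det₂ (toPlane (q i + s • e i)) (toPlane (e j)) ≤ 0 := by
  have hs' : (1 : ℝ) ≤ s := by exact_mod_cast hs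
  have hsL' : (s : ℝ) + 1 ≤ L i := by exact_mod_cast hsL
  have hd : ∀ i, (1 : ℝ) ≤ d i := fun i => by exact_mod_cast R.dpos i
  set v := toPlane (q i + s • e i) with hv
  have hvi : det₂ v (toPlane (e i)) = 1 := by
    rw [hv, toPlane_add, toPlane_zsmul, det₂_add_left, det₂_smul_left, det₂_self, R.height',
      mul_zero, add_zero]
  -- The three-term relation expresses the height of `v` over e_j through its heights over e_i and a
  -- neighbouring edge.
  have hcomb : ∀ a b : ℝ × ℝ, det₂ a b * det₂ v (toPlane (e j))
      = det₂ (toPlane (e j)) b * det₂ v a + det₂ a (toPlane (e j)) * det₂ v b := by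
    intro a b; simp only [det₂]; ring
  rcases lt_trichotomy (det₂ (toPlane (e i)) (toPlane (e j))) 0 with h | h | h
  · obtain ⟨k, rfl⟩ := (finRotate n).surjective i
    have hk : det₂ (toPlane (e k)) (toPlane (e j)) ≤ 0 := by
      by_contra hc
      push Not at hc
      exact absurd (D.no_between hc) (not_le.2 h)
    -- The height is 1 - s d_k, nonpositive since s ≥ 1; over the following edge it is 1 - (L_i - s)
    -- d_i, where L_i - s ≥ 1.
    have hvk : det₂ v (toPlane (e k)) ≤ 0 := by
      rw [hv, toPlane_add, toPlane_zsmul, det₂_add_left, det₂_smul_left, R.height_succ,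
        det₂_swap, R.det₂_dual]
      have := hd k
      nlinarith
    have := hcomb (toPlane (e k)) (toPlane (e (finRotate n k)))
    rw [hvi, mul_one, det₂_swap (toPlane (e j))] at this
    have h1 := mul_nonneg (neg_pos.2 h).le (neg_nonneg.2 hvk)
    have h2 := D.turn k
    by_contra hc
    push Not at hc
    have := mul_pos h2 hc
    linarith
  · rw [det₂_toPlane, Int.cast_eq_zero] at h
    rcases eq_or_eq_neg_of_isCoprime (D.prim i) (D.prim j) h with h | h
    · exact absurd (D.edge_injective h) hij
    · rw [h, toPlane_neg]
      have : det₂ v (-toPlane (e i)) = -det₂ v (toPlane (e i)) := by simp [det₂]; ring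
      rw [this, hvi]; norm_num
  · have hk := D.no_between h
    have hvk : det₂ v (toPlane (e (finRotate n i))) ≤ 0 := by
      have hq : q i + s • e i = q (finRotate n i) + (s - L i) • e i := by
        rw [R.move, sub_smul]; abel
      rw [hv, hq, toPlane_add, toPlane_zsmul, det₂_add_left, det₂_smul_left, R.height',
        R.det₂_dual]
      push_cast
      have := hd i
      nlinarith
    have := hcomb (toPlane (e i)) (toPlane (e (finRotate n i)))
    rw [hvi, mul_one, det₂_swap (toPlane (e j))] at this
    have h1 := mul_nonneg h.le (neg_nonneg.2 hvk)
    have h2 := D.turn i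
    by_contra hc
    push Not at hc
    have := mul_pos h2 hc
    linarith

end EdgeData

lemma isBounded_of_eq_convexHull {Δ : Set (ℝ × ℝ)} {S : Finset (ℤ × ℤ)}
    (hΔ : Δ = convexHull ℝ (toPlane '' (S : Set (ℤ × ℤ)))) : Bornology.IsBounded Δ := by
  rw [hΔ, isBounded_convexHull]
  exact (S.finite_toSet.image _).isBounded

/-- An interior lattice point is on no facet, so every column vector moves it within Δ. Finiteness
matters because `Set.ncard` is 0 on infinite sets. -/
lemma finite_columnVectors {Δ : Set (ℝ × ℝ)} (hΔ : Bornology.IsBounded Δ) {z : ℤ × ℤ}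
    (hz : toPlane z ∈ interior Δ) : {v : ℤ × ℤ | IsColumnVector Δ v}.Finite := by
  refine ((finite_lattice_of_isBounded hΔ).image fun y => y - z).subset ?_
  rintro v ⟨-, τ, ⟨a, b, hab, rfl⟩, h⟩
  have hzτ : toPlane z ∈ Δ \ {x ∈ Δ | linForm a x = b} := by
    refine ⟨interior_subset hz, fun hc => ?_⟩
    have hne : toPlane (-a.2, a.1) ≠ 0 := toPlane_ne_zero_of_isCoprime hab.1.symm.neg_left
    obtain ⟨x, hx, hlt⟩ := exists_det₂_gt_of_mem_interior hz hne
    rw [← linForm_eq_det₂, ← linForm_eq_det₂, hc.2] at hlt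
    exact absurd (hab.2.1 x hx) (not_le.2 hlt)
  exact ⟨v + z, h z hzτ, by simp⟩

namespace EdgeData

variable {Δ : Set (ℝ × ℝ)} {S : Finset (ℤ × ℤ)} {n : ℕ} {p : Fin n → ℝ × ℝ} {e : Fin n → ℤ × ℤ}
  {l : Fin n → ℤ}

/-- The vectors q_i + s e_i with 0 < s < L_i have height one over edge `i` and at most zero over
every other edge. Adding one to a lattice point off the relaxed facet `i` therefore stays in Δ, and
the edge of height one identifies `i`. -/
theorem sum_le_columnCount (hΔ : Δ = convexHull ℝ (toPlane '' (S : Set (ℤ × ℤ))))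
    (hmax : IsMaximalPolytope Δ) (D : EdgeData (interiorPolytope Δ) p e l) {q : Fin n → ℤ × ℤ}
    {L d : Fin n → ℤ} (R : RelaxData e q L d) :
    ∑ i, max 0 (L i - 1) ≤ (columnCount Δ : ℤ) := by
  obtain ⟨hmem, hPΔ⟩ := mem_iff_of_isMaximal hΔ hmax D R
  have hbdd := isBounded_of_eq_convexHull hΔ
  have hconv : Convex ℝ Δ := hΔ ▸ convex_convexHull ℝ _
  have hfin : {v : ℤ × ℤ | IsColumnVector Δ v}.Finite := by
    obtain ⟨z, hz⟩ := D.lattice ⟨0, D.pos⟩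
    refine finite_columnVectors hbdd (z := z) ?_
    rw [hz]
    exact interiorPolytope_subset_interior hconv (D.vertex_mem _)
  let f : (Σ i : Fin n, Fin (L i - 1).toNat) → ℤ × ℤ :=
    fun a => q a.1 + (((a.2 : ℕ) : ℤ) + 1) • e a.1
  have hbd : ∀ a : (Σ i : Fin n, Fin (L i - 1).toNat), (((a.2 : ℕ) : ℤ) + 1) + 1 ≤ L a.1 := by
    intro a
    have := a.2.2
    omega
  have hone : ∀ a, det₂ (toPlane (f a)) (toPlane (e a.1)) = 1 := by
    intro a
    simp only [f]
    rw [toPlane_add, toPlane_zsmul, det₂_add_left, det₂_smul_left, det₂_self, R.height', mul_zero,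
      add_zero]
  have hle : ∀ a j, j ≠ a.1 → det₂ (toPlane (f a)) (toPlane (e j)) ≤ 0 := fun a j hj =>
    D.column_le R hj (by omega) (hbd a)
  have hinj : Function.Injective f := by
    intro a b hab
    have h1 : a.1 = b.1 := by
      by_contra hne
      have := hle b a.1 hne
      rw [← hab, hone] at this
      norm_num at this
    obtain ⟨i, s⟩ := a
    obtain ⟨j, t⟩ := b
    simp only at h1
    subst h1
    have h3 := congrArg toPlane (add_left_cancel hab)
    rw [toPlane_zsmul, toPlane_zsmul] at h3
    have h4 := smul_left_injective ℝ (D.edge_ne_zero i) h3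
    have h5 : (s : ℕ) = t := by
      have h6 : (((s : ℕ) : ℤ) + 1 : ℤ) = ((t : ℕ) : ℤ) + 1 := by exact_mod_cast h4
      omega
    rw [Fin.ext h5]
  have hcol : ∀ a, IsColumnVector Δ (f a) := by
    intro a
    obtain ⟨b, hb⟩ := D.exists_int_det₂ a.1 (e a.1)
    have hb' : det₂ (p a.1 + toPlane (q a.1)) (toPlane (e a.1)) = (b + 1 : ℤ) := by
      rw [R.det₂_add, hb]; push_cast; rfl
    have hpos : 0 < l a.1 + L a.1 := by
      have := D.lpos a.1
      have := hbd a
      omega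
    refine ⟨fun h0 => ?_, {x ∈ Δ | linForm (conormal (e a.1)) x = (b + 1 : ℤ)},
      ⟨_, _, D.isFacetInequality (P := fun i => p i + toPlane (q i)) (l' := fun i => l i + L i)
        (D.relax_step R) (fun x hx => (hmem x).1 hx) hPΔ hpos hb', rfl⟩, ?_⟩
    · have := hone a
      rw [h0, toPlane_zero] at this
      simp [det₂] at this
    · rintro z ⟨hz, hzτ⟩
      rw [hmem]
      intro j
      have h1 := (hmem _).1 hz j
      rw [toPlane_add, det₂_add_left]
      by_cases hj : j = a.1
      · subst hj
        rw [hone, hb']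
        rw [hb'] at h1
        have h2 : det₂ (toPlane z) (toPlane (e a.1)) ≠ (b + 1 : ℤ) := fun h =>
          hzτ ⟨hz, by rw [linForm_conormal, h]⟩
        have h3 := lt_of_le_of_ne h1 h2
        rw [det₂_toPlane] at h3 ⊢
        have h4 := Int.cast_lt.1 h3
        have h5 : 1 + (z.1 * (e a.1).2 - z.2 * (e a.1).1) ≤ b + 1 := by omega
        exact_mod_cast h5
      · have := hle a j hj
        linarith
  have hcard : (Set.range f).ncard ≤ columnCount Δ :=
    Set.ncard_le_ncard (Set.range_subset_iff.2 hcol) hfin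
  rw [← Set.image_univ, Set.ncard_image_of_injective _ hinj, Set.ncard_univ,
    Nat.card_eq_fintype_card, Fintype.card_sigma] at hcard
  have hcard' : ((∑ i, Fintype.card (Fin (L i - 1).toNat) : ℕ) : ℤ) ≤ columnCount Δ := by
    exact_mod_cast hcard
  refine le_trans (le_of_eq ?_) hcard'
  push_cast
  refine Finset.sum_congr rfl fun i _ => ?_
  rw [Fintype.card_fin, Int.toNat_eq_max, max_comm]

theorem boundaryCount_sub (hΔ : Δ = convexHull ℝ (toPlane '' (S : Set (ℤ × ℤ))))
    (hmax : IsMaximalPolytope Δ) (D : EdgeData (interiorPolytope Δ) p e l) {q : Fin n → ℤ × ℤ}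
    {L d : Fin n → ℤ} (R : RelaxData e q L d) :
    (boundaryCount Δ : ℤ) - boundaryCount (interiorPolytope Δ) = ∑ i, L i := by
  obtain ⟨hmem, hPΔ⟩ := mem_iff_of_isMaximal hΔ hmax D R
  obtain ⟨y, hyΓ, hy⟩ := D.exists_strict
  have h1 := D.boundaryCount_eq D.lattice (fun i => (D.lpos i).le) D.step D.mem_iff D.vertex_mem hy
  have h2 := D.boundaryCount_eq (P := fun i => p i + toPlane (q i)) (l' := fun i => l i + L i)
    (fun i => by
      obtain ⟨a, ha⟩ := D.lattice i
      exact ⟨a + q i, by rw [toPlane_add, ha]⟩)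
    (relax_length_nonneg hΔ D R) (D.relax_step R) hmem hPΔ (y := y)
    (fun i => by rw [R.det₂_add]; linarith [hy i])
  rw [h1, h2, Finset.sum_add_distrib]
  ring

end EdgeData

/-! ### The associated loop and its dual -/

lemma det₂_eq_zero_of_collinear {a b c : ℝ × ℝ} (h : Collinear ℝ {a, b, c}) :
    det₂ (b - a) (c - b) = 0 := by
  obtain ⟨v, hv⟩ := (collinear_iff_of_mem (p₀ := a) (by simp)).1 h
  obtain ⟨s, hs⟩ := hv b (by simp)
  obtain ⟨t, ht⟩ := hv c (by simp)
  rw [hs, ht]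
  simp only [vadd_eq_add, det₂, Prod.fst_sub, Prod.snd_sub, Prod.fst_add, Prod.snd_add,
    Prod.smul_fst, Prod.smul_snd, smul_eq_mul]
  ring

/-- Two distinct lattice points at height one over a primitive direction form a legal move. -/
lemma isLegalMove_of_height_one {e q : ℤ × ℤ} {L : ℤ} (hL : L ≠ 0)
    (hq : det₂ (toPlane q) (toPlane e) = 1) : IsLegalMove (toPlane q) (toPlane (q + L • e)) := by
  have hq' : det₂ (toPlane (q + L • e)) (toPlane e) = 1 := by
    rw [toPlane_add, toPlane_zsmul, det₂_add_left, det₂_smul_left, det₂_self, hq, mul_zero,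
      add_zero]
  refine ⟨⟨q, rfl⟩, ⟨_, rfl⟩, fun h => ?_, fun z hz0 hz => ?_⟩
  · have := det₂_eq_zero_of_collinear h
    rw [sub_zero, toPlane_add, toPlane_zsmul, add_sub_cancel_left, det₂_smul_right, hq,
      mul_one] at this
    exact hL (by exact_mod_cast this)
  · rw [convexHull_insert ⟨toPlane q, by simp⟩, mem_convexJoin] at hz
    obtain ⟨o, ho, y, hy, hzy⟩ := hz
    rw [Set.mem_singleton_iff] at ho
    subst ho
    rw [convexHull_pair] at hy
    have hy1 : det₂ y (toPlane e) = 1 := by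
      obtain ⟨a, b, -, -, hab, rfl⟩ := hy
      rw [det₂_add_left, det₂_smul_left, det₂_smul_left, hq, hq', mul_one, mul_one, hab]
    obtain ⟨a, t, ha, ht, hat, hz⟩ := hzy
    rw [smul_zero, zero_add] at hz
    have hzt : det₂ (toPlane z) (toPlane e) = t := by rw [← hz, det₂_smul_left, hy1, mul_one]
    rw [det₂_toPlane] at hzt
    set k := z.1 * e.2 - z.2 * e.1
    have hk0 : 0 ≤ k := by exact_mod_cast hzt ▸ ht
    have hk1 : k ≤ 1 := by
      have : (k : ℝ) ≤ 1 := by rw [hzt]; linarith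
      exact_mod_cast this
    -- Lattice points of the triangle have integral height in [0, 1]: height 0 is the origin, height
    -- 1 the opposite edge.
    have hk : k = 0 ∨ k = 1 := by omega
    rcases hk with hk | hk
    · rw [hk, Int.cast_zero] at hzt
      rw [← hzt, zero_smul, ← toPlane_zero] at hz
      exact absurd (toPlane_injective hz).symm hz0
    · rw [hk, Int.cast_one] at hzt
      rw [← hzt, one_smul] at hz
      rwa [← hz]

lemma finRotate_finRotate_eq_self {m : ℕ} (hm : m ≤ 2) (j : Fin m) :
    finRotate m (finRotate m j) = j := by
  interval_cases m
  · exact j.elim0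
  · exact Subsingleton.elim _ _
  · revert j; decide

/-- The shape of the loop obtained from the vectors `q i` by omitting repetitions: the `j`-th
move goes over the edge `k j`, and the moves of the dual loop have positive lengths `X j`. -/
theorem RelaxData.exists_subloop {n m : ℕ} {e q : Fin n → ℤ × ℤ} {L d : Fin n → ℤ}
    (R : RelaxData e q L d) {k : Fin m → Fin n} (hk : StrictMono k)
    (hrange : ∀ i, i ∈ Set.range k ↔ L i ≠ 0) (hm : 0 < m) :
    ∃ X : Fin m → ℤ, (∀ j, q (k (finRotate m j)) = q (k j) + L (k j) • e (k j)) ∧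
      (∀ j, det₂ (toPlane (e (k j))) (toPlane (e (k (finRotate m j)))) = X j) ∧
      (∀ j, 1 ≤ X j) ∧ ∑ j, X j = ∑ i, d i := by
  obtain ⟨r, hr1, hr2, hr3⟩ := exists_cyclic_ceil hk hm
  have hne : (Set.range k).Nonempty := ⟨_, ⟨0, hm⟩, rfl⟩
  have hmove : ∀ i, i ∉ Set.range k → q (finRotate n i) = q i := by
    intro i hi
    rw [hrange, not_not] at hi
    rw [R.move, hi, zero_smul, add_zero]
  have hq : ∀ i, q (k (r i)) = q i := by
    refine finRotate_backward_induction hne ?_ ?_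
    · rintro _ ⟨j, rfl⟩
      rw [hr1]
    · intro i hi ih
      rw [hr2 i hi, ih, hmove i hi]
  have hinj : ∀ i (a b : ℤ), a • q i = b • q i → a = b := by
    intro i a b hab
    have h := R.height i
    have h1 := congrArg Prod.fst hab
    have h2 := congrArg Prod.snd hab
    simp only [Prod.smul_fst, Prod.smul_snd, smul_eq_mul] at h1 h2
    linear_combination (b - a) * h + (e i).2 * h1 - (e i).1 * h2
  -- From `i` to the next index with a nonzero move `q` is constant, so `e` keeps moving along one
  -- line; `D i` accumulates the dual lengths passed.
  have hE : ∀ i, ∃ D : ℤ, 0 ≤ D ∧ e (k (r i)) = e i - D • q i := by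
    refine finRotate_backward_induction hne ?_ ?_
    · rintro _ ⟨j, rfl⟩
      exact ⟨0, le_rfl, by rw [hr1, zero_smul, sub_zero]⟩
    · rintro i hi ⟨D, hD, h⟩
      have := R.dpos i
      refine ⟨d i + D, by omega, ?_⟩
      rw [hr2 i hi, h, R.dual, hmove i hi, add_smul]
      abel
  choose D hD0 hD using hE
  have hDk : ∀ j, D (k j) = 0 := by
    intro j
    have := hD (k j)
    rw [hr1] at this
    refine hinj (k j) _ _ ?_
    rw [zero_smul]
    exact sub_eq_self.1 this.symm
  have hDi : ∀ i, i ∉ Set.range k → D i = d i + D (finRotate n i) := by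
    intro i hi
    have h1 := hD i
    rw [hr2 i hi, hD, R.dual, hmove i hi, sub_sub, ← add_smul] at h1
    exact (hinj i _ _ (sub_right_injective h1)).symm
  have hX : ∀ j, e (k (finRotate m j))
      = e (k j) - (d (k j) + D (finRotate n (k j))) • q (finRotate n (k j)) := by
    intro j
    rw [← hr3, hD, R.dual, add_smul]
    abel
  refine ⟨fun j => d (k j) + D (finRotate n (k j)), fun j => ?_, fun j => ?_, fun j => ?_, ?_⟩
  · rw [← hr3, hq, R.move]
  · rw [hX, toPlane_sub, toPlane_zsmul, det₂_sub_right, det₂_smul_right, det₂_self, det₂_swap,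
      R.height_succ]
    push_cast
    ring
  · have := R.dpos (k j)
    have := hD0 (finRotate n (k j))
    simp only
    omega
  · have h2 : ∑ i, (d i + D (finRotate n i) - D i) = ∑ i, d i := by
      rw [Finset.sum_sub_distrib, Finset.sum_add_distrib, Equiv.sum_comp (finRotate n) D,
        add_sub_cancel_right]
    have h1 := sum_comp_eq_of_support_subset hk.injective
      (fun i => d i + D (finRotate n i) - D i) (fun i hi => by rw [hDi i hi, sub_self])
    rw [← h2, ← h1]
    refine Finset.sum_congr rfl fun j _ => ?_
    rw [hDk, sub_zero]

lemma finite_interiorLatticePoints {Δ : Set (ℝ × ℝ)} (hΔ : Bornology.IsBounded Δ) :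
    (interiorLatticePoints Δ).Finite := by
  refine (finite_lattice_of_isBounded hΔ).subset fun z hz => ?_
  exact interior_subset (s := Δ) hz

lemma exists_edgeData_relaxData {Δ : Set (ℝ × ℝ)} {S : Finset (ℤ × ℤ)}
    (hΔ : Δ = convexHull ℝ (toPlane '' (S : Set (ℤ × ℤ)))) (hnh : IsNonhyperelliptic Δ) {n : ℕ}
    {p : Fin n → ℝ × ℝ} (hp : IsCounterclockwiseEnum (interiorPolytope Δ) p) :
    ∃ e l q L d, EdgeData (interiorPolytope Δ) p e l ∧ RelaxData (n := n) e q L d := by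
  have hfin := finite_interiorLatticePoints (isBounded_of_eq_convexHull hΔ)
  obtain ⟨e, l, D⟩ := hp.exists_edgeData (hfin.image toPlane) (Set.image_subset_range _ _) rfl
    (fun h => hnh (collinear_convexHull_iff.1 h))
  obtain ⟨q, L, d, R⟩ := D.exists_relaxData hΔ
  exact ⟨e, l, q, L, d, D, R⟩

theorem exists_isAssociatedLoop {Δ : Set (ℝ × ℝ)} {S : Finset (ℤ × ℤ)}
    (hΔ : Δ = convexHull ℝ (toPlane '' (S : Set (ℤ × ℤ)))) (hnh : IsNonhyperelliptic Δ) :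
    ∃ (n : ℕ) (v : Fin n → ℝ × ℝ), IsAssociatedLoop Δ v := by
  have hfin := finite_interiorLatticePoints (isBounded_of_eq_convexHull hΔ)
  obtain ⟨n, p, hp⟩ := exists_counterclockwiseEnum (Γ := interiorPolytope Δ)
    (hfin.image toPlane) rfl (fun h => hnh (collinear_convexHull_iff.1 h))
  obtain ⟨e, l, q, L, d, D, R⟩ := exists_edgeData_relaxData hΔ hnh hp
  obtain ⟨m, k, hk, hrange⟩ := exists_strictMono_range_eq
    {i | (p i + toPlane (q i)) - p i
      ≠ (p (finRotate n i) + toPlane (q (finRotate n i))) - p (finRotate n i)}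
  refine ⟨m, _, n, p, fun i => p i + toPlane (q i), hp, fun i => ?_, k, hk, hrange, rfl⟩
  obtain ⟨i, rfl⟩ := (finRotate n).surjective i
  rw [D.isRelaxedVertex_iff, add_sub_cancel_left]
  exact ⟨R.height_succ i, R.height' _⟩

theorem mainTheorem5 (Δ : Set (ℝ × ℝ)) (hΔ : IsLatticePolytope Δ)
    (hmax : IsMaximalPolytope Δ) (hnh : IsNonhyperelliptic Δ) :
    (∃ (n : ℕ) (v : Fin n → ℝ × ℝ), IsAssociatedLoop Δ v) ∧
    ∀ (n : ℕ) (v : Fin n → ℝ × ℝ), IsAssociatedLoop Δ v →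
      IsLegalLoop v ∧
      ((boundaryCount Δ : ℝ) - (boundaryCount (interiorPolytope Δ) : ℝ) = loopLength v ∧
        loopLength v ≤ 9) ∧
      ((boundaryCount Δ : ℝ) - (boundaryCount (interiorPolytope Δ) : ℝ) - (columnCount Δ : ℝ)
          ≤ min (loopLength v) (loopLength (dualLoop v)) ∧
        min (loopLength v) (loopLength (dualLoop v)) ≤ 6) := by
  obtain ⟨S, hS⟩ := hΔ
  refine ⟨exists_isAssociatedLoop hS hnh, ?_⟩
  rintro m v ⟨n, p, p', hp, hp', k, hk, hrange, hv⟩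
  obtain ⟨e, l, q, L, d, D, R⟩ := exists_edgeData_relaxData hS hnh hp
  have hpq : ∀ i, p' i - p i = toPlane (q i) := by
    intro i
    obtain ⟨i, rfl⟩ := (finRotate n).surjective i
    obtain ⟨h1, h2⟩ := (D.isRelaxedVertex_iff i _).1 (hp' (finRotate n i))
    refine sub_eq_zero.1 (eq_zero_of_det₂_eq_zero (D.turn i).ne' ?_ ?_)
    · rw [det₂_sub_left, h1, R.height_succ, sub_self]
    · rw [det₂_sub_left, h2, R.height', sub_self]
  simp only [hpq] at hrange
  have hvq : ∀ j, v j = toPlane (q (k j)) := fun j => by rw [hv, Function.comp_apply, hpq]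
  have hrangeL : ∀ i, i ∈ Set.range k ↔ L i ≠ 0 := by
    intro i
    rw [hrange, Set.mem_ofPred_eq, R.move, not_iff_not, toPlane_injective.eq_iff]
    rw [left_eq_add]
    refine ⟨fun h => ?_, fun h => by rw [h, zero_smul]⟩
    have := congrArg toPlane h
    rw [toPlane_zsmul, toPlane_zero] at this
    rcases smul_eq_zero.1 this with h | h
    · exact_mod_cast h
    · exact absurd h (D.edge_ne_zero i)
  have hm : 0 < m := by
    rw [Nat.pos_iff_ne_zero]
    rintro rfl
    -- An empty loop would make all `q i` equal to one vector of height one over every edge,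
    -- contradicting ∑ l_i e_i = 0.
    have hL0 : ∀ i, L i = 0 := fun i => by
      by_contra h
      obtain ⟨j, -⟩ := (hrangeL i).2 h
      exact j.elim0
    set i₀ : Fin n := ⟨0, D.pos⟩
    have hall : ∀ i, q i = q i₀ := finRotate_induction (i := i₀) (P := fun i => q i = q i₀)
      (fun i hi => by rw [R.move, hL0, zero_smul, add_zero, hi]) rfl
    have h1 := D.sum_mul_det₂_eq_zero (toPlane (q i₀))
    have h2 : ∀ i, (l i : ℝ) * det₂ (toPlane (q i₀)) (toPlane (e i)) = l i := fun i => by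
      rw [← hall i, R.height', mul_one]
    simp only [h2] at h1
    have h3 := Finset.sum_pos (fun i _ => D.lpos_real i) ⟨i₀, Finset.mem_univ _⟩
    linarith
  obtain ⟨X, hmove, hXdet, hX1, hXsum⟩ := R.exists_subloop hk hrangeL hm
  have hLk : ∀ j, L (k j) ≠ 0 := fun j => (hrangeL _).1 ⟨j, rfl⟩
  have hdiff : ∀ j, v (finRotate m j) - v j = (L (k j) : ℝ) • toPlane (e (k j)) := by
    intro j
    rw [hvq, hvq, hmove, toPlane_add, toPlane_zsmul, add_sub_cancel_left]
  have hdet : ∀ j, det₂ (v j) (v (finRotate m j)) = L (k j) := by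
    intro j
    rw [hvq, hvq, hmove, toPlane_add, toPlane_zsmul, det₂_add_right, det₂_smul_right, det₂_self,
      R.height']
    ring
  have htriple : ∀ j, det₂ (v (finRotate m j) - v j)
      (v (finRotate m (finRotate m j)) - v (finRotate m j)) ≠ 0 := by
    intro j
    rw [hdiff, hdiff, det₂_smul_left, det₂_smul_right, hXdet]
    have h1 := hX1 j
    have h2 : X j ≠ 0 := by omega
    exact mul_ne_zero (by exact_mod_cast hLk j)
      (mul_ne_zero (by exact_mod_cast hLk _) (by exact_mod_cast h2))
  have hlegal : IsLegalLoop v := by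
    refine ⟨fun j => ?_, fun j h => htriple j (det₂_eq_zero_of_collinear h)⟩
    rw [hvq, hvq, hmove]
    exact isLegalMove_of_height_one (hLk j) (R.height' _)
  -- With at most two terms, consecutive differences would be opposite, hence of determinant zero.
  have hm3 : 3 ≤ m := by
    by_contra hc
    have := htriple ⟨0, hm⟩
    rw [finRotate_finRotate_eq_self (by omega)] at this
    apply this
    simp only [det₂, Prod.fst_sub, Prod.snd_sub]
    ring
  have hlen : loopLength v = ((∑ i, L i : ℤ) : ℝ) := by
    rw [← sum_comp_eq_of_support_subset hk.injective L
      (fun i hi => by rwa [hrangeL, not_not] at hi), loopLength]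
    push_cast
    exact Finset.sum_congr rfl fun j _ => hdet j
  have hdual : ∀ j, dualLoop v j = toPlane (e (k j)) := by
    intro j
    have : (L (k j) : ℝ) ≠ 0 := by exact_mod_cast hLk j
    rw [dualLoop, hdet, hdiff, smul_smul, inv_mul_cancel₀ this, one_smul]
  have hlen' : loopLength (dualLoop v) = ((∑ i, d i : ℤ) : ℝ) := by
    rw [← hXsum, loopLength]
    push_cast
    exact Finset.sum_congr rfl fun j _ => by rw [hdual, hdual, hXdet]
  have h12 := D.sum_add_sum_eq_twelve R
  have hdm : (m : ℤ) ≤ ∑ i, d i := by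
    rw [← hXsum]
    calc (m : ℤ) = ∑ _j : Fin m, (1 : ℤ) := by simp
      _ ≤ _ := Finset.sum_le_sum fun j _ => hX1 j
  have hr := D.boundaryCount_sub hS hmax R
  have hr' : (boundaryCount Δ : ℝ) - (boundaryCount (interiorPolytope Δ) : ℝ)
      = ((∑ i, L i : ℤ) : ℝ) := by exact_mod_cast hr
  -- Each loop term contributes L - max(0, L - 1) ≤ 1, so the left side is at most `m`, which `hdm`
  -- bounds.
  have hcol : ∑ i, L i - (columnCount Δ : ℤ) ≤ ∑ i, d i := by
    have h1 := D.sum_le_columnCount hS hmax R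
    have h2 : ∑ i, (L i - max 0 (L i - 1)) ≤ (m : ℤ) := by
      rw [← sum_comp_eq_of_support_subset hk.injective (fun i => L i - max 0 (L i - 1))
        (fun i hi => by
          rw [hrangeL, not_not] at hi
          rw [hi]; norm_num)]
      calc _ ≤ ∑ _j : Fin m, (1 : ℤ) := Finset.sum_le_sum fun j _ => by
            have := le_max_right 0 (L (k j) - 1)
            omega
        _ = m := by simp
    rw [Finset.sum_sub_distrib] at h2
    omega
  refine ⟨hlegal, ⟨hr'.trans hlen.symm, ?_⟩, ?_, ?_⟩
  · rw [hlen]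
    have : ∑ i, L i ≤ 9 := by omega
    exact_mod_cast this
  · rw [hr', hlen, hlen', le_min_iff]
    constructor
    · have : (0 : ℝ) ≤ columnCount Δ := Nat.cast_nonneg _
      linarith
    · exact_mod_cast hcol
  · rw [hlen, hlen', min_le_iff]
    have : ∑ i, L i ≤ 6 ∨ ∑ i, d i ≤ 6 := by omega
    rcases this with h | h
    · left; exact_mod_cast h
    · right; exact_mod_cast h
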